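/- For a unital C*-algebra $A$ and positive matrices $a \in M_n(A)_+$, $b \in M_m(A)_+$ (elements of $M_\infty(A)_+$), write $a \precsim_A b$ (Cuntz subequivalence) if for every $\varepsilon > 0$ there is $v \in M_{m,n}(A)$ with $\|v^* b v - a\| < \varepsilon$. Let $\mathrm{LDF}(A)$ be the set of normalized lower semicontinuous dimension functions on $A$, that is, the functions $d \colon M_\infty(A)_+ \to [0,\infty)$ such that $a \precsim_A b$ implies $d(a) \le d(b)$, $d(a \oplus b) = d(a) + d(b)$, $d(1_A) = 1$, and $d$ is lower semicontinuous in norm. For $r \in [0,\infty)$, $A$ has $r$-comparison if, for all $a, b \in M_\infty(A)_+$ such that $d(a) + r < d(b)$ for every $d \in \mathrm{LDF}(A)$, one has $a \precsim_A b$. The radius of comparison $\operatorname{rc}(A) \in [0,\infty]$ is the infimum of all $r \in [0,\infty)$ such that $A$ has $r$-comparison ($\infty$ if there is no such $r$). A unital C*-algebra $B$ is stably finite if for every $n$ every isometry in $M_n(B)$ is unitary. (Quotients are quotients by closed two-sided ideals.) **Lemma.** Let $A$ be a unital C*-algebra all of whose quotients are stably finite, and let $r \in [0, \infty)$. Suppose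 that for every finite set $F \subset A$ and every $\varepsilon > 0$ there are a unital C*-algebra $C$ all of whose quotients are stably finite and an injective unital $*$-homomorphism $\varphi \colon C \to A$ such that $\operatorname{rc}(C) < r + \varepsilon$ and $\operatorname{dist}(a, \varphi(C)) < \varepsilon$ for all $a \in F$. Then $\operatorname{rc}(A) \le r$. -/

import Mathlib

universe u

/-- A (unital) `*`-ring `B`, typically a unital C*-algebra or a quotient of one, is stably finite
if every isometry in every matrix algebra `M_n(B)` is a unitary. -/
def StablyFinite (B : Type*) [Ring B] [StarRing B] : Prop :=
  ∀ (n : ℕ) (v : Matrix (Fin n) (Fin n) B), star v * v = 1 → v * star v = 1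

/-- All quotients of the unital C*-algebra `A` by closed two-sided ideals are stably finite.
Up to `*`-isomorphism, the quotients `A ⧸ I` with `I` a closed two-sided ideal are exactly the
`*`-algebras `B` that receive a surjective unital `*`-homomorphism from `A` with closed kernel.
(The zero algebra `A ⧸ A` is included; it is stably finite.) -/
def AllQuotientsStablyFinite (A : Type u) [CStarAlgebra A] : Prop :=
  ∀ (B : Type u) [Ring B] [StarRing B] [Algebra ℂ B] (π : A →⋆ₐ[ℂ] B),
    Function.Surjective π → IsClosed {a : A | π a = 0} → StablyFinite B

section Cuntz

variable {A : Type u} [CStarAlgebra A] [PartialOrder A] [StarOrderedRing A]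

/-- Cuntz subequivalence `a ≾ b` in `M_∞(A)` of square matrices `a ∈ M_n(A)`, `b ∈ M_m(A)`
(used for positive `a`, `b`): there are `v ∈ M_{m,n}(A)` with `v* b v` arbitrarily close to `a`. -/
def CuntzLE {n m : ℕ} (a : CStarMatrix (Fin n) (Fin n) A) (b : CStarMatrix (Fin m) (Fin m) A) :
    Prop :=
  ∀ ε : ℝ, 0 < ε → ∃ v : CStarMatrix (Fin m) (Fin n) A, ‖v.conjTranspose * b * v - a‖ < ε

/-- The block diagonal matrix `a ⊕ b = diag(a, b) ∈ M_{n+m}(A)`. -/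
def matDirectSum {n m : ℕ} (a : CStarMatrix (Fin n) (Fin n) A)
    (b : CStarMatrix (Fin m) (Fin m) A) : CStarMatrix (Fin (n + m)) (Fin (n + m)) A :=
  CStarMatrix.ofMatrix <| Matrix.reindex finSumFinEquiv finSumFinEquiv <|
    Matrix.fromBlocks (CStarMatrix.ofMatrix.symm a) 0 0 (CStarMatrix.ofMatrix.symm b)

variable (A) in
/-- A normalized lower semicontinuous dimension function on `A`, that is, an element of `LDF(A)`:
an additive, order preserving function on the Cuntz semigroup `W(A)` of positive matrices over `A`,
with values in `[0, ∞)` and value `1` at the class of `1_A`, that is lower semicontinuous on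
the positive matrices of each size.  Its values at matrices that are not positive are
irrelevant. -/
structure LowerSemicontinuousDimensionFunction where
  /-- the value at an `n × n` matrix -/
  toFun : (n : ℕ) → CStarMatrix (Fin n) (Fin n) A → ℝ
  nonneg : ∀ {n : ℕ} (a : CStarMatrix (Fin n) (Fin n) A), 0 ≤ a → 0 ≤ toFun n a
  mono : ∀ {n m : ℕ} (a : CStarMatrix (Fin n) (Fin n) A) (b : CStarMatrix (Fin m) (Fin m) A),
    0 ≤ a → 0 ≤ b → CuntzLE a b → toFun n a ≤ toFun m b
  add : ∀ {n m : ℕ} (a : CStarMatrix (Fin n) (Fin n) A) (b : CStarMatrix (Fin m) (Fin m) A),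
    0 ≤ a → 0 ≤ b → toFun (n + m) (matDirectSum a b) = toFun n a + toFun m b
  one : toFun 1 1 = 1
  lowerSemicontinuous : ∀ n : ℕ, LowerSemicontinuousOn (toFun n) {a | 0 ≤ a}

variable (A) in
/-- `A` has `r`-comparison: for all positive matrices `a`, `b` over `A`, if `d(a) + r < d(b)` for
every normalized lower semicontinuous dimension function `d` on `A`, then `a ≾ b`. -/
def HasComparison (r : NNReal) : Prop :=
  ∀ (n m : ℕ) (a : CStarMatrix (Fin n) (Fin n) A) (b : CStarMatrix (Fin m) (Fin m) A),
    0 ≤ a → 0 ≤ b →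
    (∀ d : LowerSemicontinuousDimensionFunction A, d.toFun n a + (r : ℝ) < d.toFun m b) →
    CuntzLE a b

variable (A) in
/-- The radius of comparison `rc(A) ∈ [0, ∞]` of the unital C*-algebra `A`: the infimum of all
`r ∈ [0, ∞)` such that `A` has `r`-comparison, and `∞` if there is no such `r`. -/
noncomputable def radiusOfComparison : ENNReal :=
  ⨅ (r : NNReal) (_ : HasComparison A r), (r : ENNReal)

end Cuntz

/-! The strict inequalities d(a) + r < d(b), one for each of infinitely many d, are converted into
one inequality in the Cuntz semigroup W(A). That inequality involves finitely many matrices, so it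
descends approximately to a suitable C.

The conversion is Hahn-Banach for ordered monoids (`exists_state_or`). With x = [(a - ε)₊], either a
normalized state f on W(A) has f[b] ≤ f(x) + r, or n x + s[1] + z ≤ n[b] + z for some s > rn. The
lower semicontinuous regularization of f takes a value at least f(x) at a and at most f[b] at b,
which rules out the first case.

To remove z, take a large multiple of the second inequality, which still carries a single z, and
absorb z into a fixed multiple of [b]. This needs b to be full, [1] ≤ N'[b]
(`exists_unit_le_nsmul`). Another use of Hahn-Banach reduces fullness to an inequality (N+1)[1] ≤
K[b] + N[1]. Modulo the closed ideal generated by the entries of b it yields an N × (N+1) isometry,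
so stable finiteness makes that quotient zero.

The result is p x + s[1] ≤ q[b] with r'q + (q - p)n < s and r' > r
(`exists_nsmul_add_nsmul_unit_le`). It transfers to x', b' over C with φ(x') close to (a - ε)₊ and
φ(b') ≾ b (`exists_finset_forall_exists_nsmul_le`). Since d(x') ≤ n, it forces d(x') + r' < d(b')
for all d in LDF(C). Comparison in C gives x' ≾ b', hence φ(x') ≾ b with φ(x') close to a. -/

set_option linter.unusedSectionVars false

/-! ### Hahn-Banach extension in abelian groups. -/

/-- A real function on an abelian group is sublinear if it is subadditive and homogeneous for
multiplication by natural numbers. -/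
structure IsSublinear {G : Type*} [AddCommGroup G] (p : G → ℝ) : Prop where
  add_le : ∀ g h, p (g + h) ≤ p g + p h
  nsmul : ∀ (n : ℕ) g, p (n • g) = n * p g

namespace IsSublinear

variable {G : Type*} [AddCommGroup G] {p : G → ℝ}

lemma map_zero (hp : IsSublinear p) : p 0 = 0 := by
  simpa using hp.nsmul 0 0

lemma neg_le (hp : IsSublinear p) (g : G) : -p (-g) ≤ p g := by
  have := hp.add_le g (-g)
  rw [add_neg_cancel, hp.map_zero] at this
  linarith

/-- The largest sublinear function below `p` that is additive in the direction of `h`. -/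
noncomputable def straighten (p : G → ℝ) (h : G) (g : G) : ℝ :=
  ⨅ n : ℕ, (p (g + n • h) - n * p h)

lemma bddBelow_straighten (hp : IsSublinear p) (h g : G) :
    BddBelow (Set.range fun n : ℕ => p (g + n • h) - n * p h) := by
  refine ⟨-p (-g), ?_⟩
  rintro _ ⟨n, rfl⟩
  have := hp.add_le (g + n • h) (-g)
  rw [show g + n • h + -g = n • h by abel, hp.nsmul] at this
  simp only
  linarith

lemma straighten_le_sub (hp : IsSublinear p) (h g : G) (n : ℕ) :
    straighten p h g ≤ p (g + n • h) - n * p h :=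
  ciInf_le (hp.bddBelow_straighten h g) n

lemma straighten_le (hp : IsSublinear p) (h g : G) : straighten p h g ≤ p g := by
  simpa using hp.straighten_le_sub h g 0

lemma isSublinear_straighten (hp : IsSublinear p) (h : G) : IsSublinear (straighten p h) := by
  have hadd : ∀ g g', IsSublinear.straighten p h (g + g') ≤
      IsSublinear.straighten p h g + IsSublinear.straighten p h g' := by
    intro g g'
    refine le_ciInf_add_ciInf fun n m => ?_
    refine (hp.straighten_le_sub h _ (n + m)).trans ?_
    have := hp.add_le (g + n • h) (g' + m • h)
    rw [show g + n • h + (g' + m • h) = g + g' + (n + m) • h by rw [add_smul]; abel] at this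
    push_cast
    linarith
  have hzero : IsSublinear.straighten p h 0 = 0 := by
    simp [IsSublinear.straighten, hp.nsmul]
  refine ⟨hadd, fun k g => le_antisymm ?_ ?_⟩
  · induction k with
    | zero => simp [hzero]
    | succ k ih =>
      rw [succ_nsmul]
      refine (hadd _ _).trans ?_
      push_cast
      linarith
  · rcases Nat.eq_zero_or_pos k with rfl | hk
    · simp [hzero]
    refine le_ciInf fun n => ?_
    have h1 := hp.straighten_le_sub h g n
    -- The terms of the infimum decrease in n: k times the n-th term for g is the (kn)-th term for
    -- k•g, which is at most the n-th.
    have h2 : p (k • g + (k * n) • h) = k * p (g + n • h) := by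
      rw [← hp.nsmul, smul_add, mul_smul]
    have h3 := hp.add_le (k • g + n • h) ((k * n - n) • h)
    have h4 : n ≤ k * n := Nat.le_mul_of_pos_left n hk
    rw [add_assoc, ← add_smul, Nat.add_sub_cancel' h4, h2, hp.nsmul, Nat.cast_sub h4] at h3
    push_cast at h3
    have h5 := mul_le_mul_of_nonneg_left h1 (Nat.cast_nonneg (α := ℝ) k)
    linarith

/-- A Hahn-Banach theorem for abelian groups. -/
theorem exists_addMonoidHom_le (hp : IsSublinear p) (g₀ : G) :
    ∃ f : G →+ ℝ, (∀ g, f g ≤ p g) ∧ f g₀ = p g₀ := by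
  let S : Set (G → ℝ)ᵒᵈ := {q | IsSublinear (OrderDual.ofDual q)}
  obtain ⟨m, hm, hmax⟩ := zorn_le_nonempty₀ S (by
    intro c hc hchain y hy
    have hne : Nonempty c := ⟨⟨y, hy⟩⟩
    have hbdd : ∀ g, BddBelow (Set.range fun q : c => (OrderDual.ofDual q.1) g) := by
      intro g
      refine ⟨-(OrderDual.ofDual y) (-g), ?_⟩
      rintro _ ⟨q, rfl⟩
      rcases hchain.total hy q.2 with h | h
      · have h1 : (OrderDual.ofDual q.1) (-g) ≤ (OrderDual.ofDual y) (-g) := h (-g)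
        have h2 := (hc q.2 : IsSublinear _).neg_le g
        simp only
        linarith
      · have h1 : (OrderDual.ofDual y) g ≤ (OrderDual.ofDual q.1) g := h g
        have h2 := (hc hy : IsSublinear _).neg_le g
        simp only
        linarith
    refine ⟨OrderDual.toDual fun g => ⨅ q : c, (OrderDual.ofDual q.1) g, ⟨?_, ?_⟩, ?_⟩
    · intro g h
      refine le_ciInf_add_ciInf fun q₁ q₂ => ?_
      rcases hchain.total q₁.2 q₂.2 with h12 | h12
      · refine (ciInf_le (hbdd _) q₂).trans (((hc q₂.2 : IsSublinear _).add_le g h).trans ?_)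
        exact add_le_add (h12 g) le_rfl
      · refine (ciInf_le (hbdd _) q₁).trans (((hc q₁.2 : IsSublinear _).add_le g h).trans ?_)
        exact add_le_add le_rfl (h12 h)
    · intro n g
      simp only [OrderDual.ofDual_toDual]
      rw [Real.mul_iInf_of_nonneg (Nat.cast_nonneg n)]
      exact iInf_congr fun q => (hc q.2 : IsSublinear _).nsmul n g
    · intro z hz g
      exact ciInf_le (hbdd g) ⟨z, hz⟩) (OrderDual.toDual (IsSublinear.straighten p g₀))
      (hp.isSublinear_straighten g₀)
  set q : G → ℝ := OrderDual.ofDual m with hq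
  have hqs : IsSublinear q := hmax.1
  have hqle : ∀ g, q g ≤ IsSublinear.straighten p g₀ g := fun g => hm g
  -- A minimal sublinear function is unchanged by straightening, and this makes it additive.
  have hmin : ∀ h g, q g ≤ IsSublinear.straighten q h g := fun h g =>
    hmax.2 (y := OrderDual.toDual (IsSublinear.straighten q h)) (hqs.isSublinear_straighten h)
      (fun g => hqs.straighten_le h g) g
  have hadd : ∀ g h, q (g + h) = q g + q h := by
    intro g h
    refine le_antisymm (hqs.add_le g h) ?_
    have := (hmin h g).trans (hqs.straighten_le_sub h g 1)
    simp only [one_smul, Nat.cast_one, one_mul] at this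
    linarith
  refine ⟨AddMonoidHom.mk' q hadd, fun g => (hqle g).trans (hp.straighten_le _ _), ?_⟩
  refine le_antisymm ((hqle g₀).trans (hp.straighten_le _ _)) ?_
  -- Starting Zorn below `straighten p g₀` gives q(-g₀) ≤ -p(g₀), so the value at g₀ is attained.
  have h1 := (hqle (-g₀)).trans (hp.straighten_le_sub g₀ (-g₀) 1)
  have h2 := hadd g₀ (-g₀)
  rw [add_neg_cancel, hqs.map_zero] at h2
  simp only [one_smul, Nat.cast_one, one_mul, neg_add_cancel, hp.map_zero] at h1
  show p g₀ ≤ q g₀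
  linarith

end IsSublinear

/-! ### States on ordered abelian groups and monoids. -/

section States

open scoped Pointwise

/-- For a cone `K` with order unit `u` in an abelian group, either some normalized positive
functional takes a value of at least `c` at `g`, or there is a multiple of `u` that shows that no
such functional exists. -/
theorem exists_positive_functional_or {G : Type*} [AddCommGroup G] (K : AddSubmonoid G) (u : G)
    (hu : ∀ g, ∃ N : ℕ, N • u - g ∈ K) (g₀ : G) (c : ℝ) :
    (∃ f : G →+ ℝ, (∀ k ∈ K, 0 ≤ f k) ∧ f u = 1 ∧ c ≤ f g₀) ∨
      ∃ (n : ℕ) (m : ℤ), 0 < n ∧ (m : ℝ) < c * n ∧ m • u - n • g₀ ∈ K := by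
  by_cases hcon : ∃ (n : ℕ) (m : ℤ), 0 < n ∧ (m : ℝ) < c * n ∧ m • u - n • g₀ ∈ K
  · exact Or.inr hcon
  left
  push Not at hcon
  have hsmul : ∀ (n : ℕ) {k : G}, k ∈ K → (n : ℤ) • k ∈ K := fun n k hk => by
    rw [natCast_zsmul]; exact K.nsmul_mem hk n
  -- Adding many copies of a negative multiple of u in K to N•u - g₀ would give a pair with n = 1
  -- excluded by `hcon`.
  have hK : ∀ m : ℤ, m • u ∈ K → 0 ≤ m := by
    intro m hm
    by_contra! hneg
    obtain ⟨N, hN⟩ := hu g₀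
    obtain ⟨j, hj⟩ := exists_nat_gt ((N : ℝ) - c)
    have h1 : ((j : ℤ) * m + N) • u - 1 • g₀ ∈ K := by
      have := K.add_mem (hsmul j hm) hN
      rwa [← add_sub_assoc, smul_smul, ← natCast_zsmul u N, ← add_smul, ← one_smul ℕ g₀] at this
    refine hcon 1 _ one_pos ?_ h1
    have h2 : (m : ℝ) ≤ -1 := by exact_mod_cast Int.le_sub_one_of_lt hneg
    push_cast
    nlinarith [Nat.cast_nonneg (α := ℝ) j]
  -- These are the upper bounds that K imposes on the value at g of a normalized positive
  -- functional. Their infimum is the sublinear function to be dominated.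
  let S : G → Set ℝ := fun g => {t | ∃ (n : ℕ) (m : ℤ), 0 < n ∧ m • u - n • g ∈ K ∧ t = m / n}
  have hadd : ∀ g h, S g + S h ⊆ S (g + h) := by
    rintro g h _ ⟨_, ⟨n, m, hn, hm, rfl⟩, _, ⟨n', m', hn', hm', rfl⟩, rfl⟩
    refine ⟨n * n', n' * m + n * m', Nat.mul_pos hn hn', ?_, ?_⟩
    · have := K.add_mem (hsmul n' hm) (hsmul n hm')
      convert this using 1
      simp only [smul_sub, add_smul, smul_add, mul_smul, natCast_zsmul]
      rw [smul_comm n n' g]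
      abel
    · have : (n : ℝ) ≠ 0 := by positivity
      have : (n' : ℝ) ≠ 0 := by positivity
      push_cast
      field_simp
  have hzero : ∀ t ∈ S 0, 0 ≤ t := by
    rintro _ ⟨n, m, hn, hm, rfl⟩
    rw [smul_zero, sub_zero] at hm
    have : (0 : ℝ) ≤ m := by exact_mod_cast hK m hm
    positivity
  have hne : ∀ g, (S g).Nonempty := by
    intro g
    obtain ⟨N, hN⟩ := hu g
    exact ⟨_, 1, N, one_pos, by simpa using hN, rfl⟩
  have hbdd : ∀ g, BddBelow (S g) := by
    intro g
    obtain ⟨t', ht'⟩ := hne (-g)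
    refine ⟨-t', fun t ht => ?_⟩
    have := hzero (t + t') (by simpa using hadd g (-g) (Set.add_mem_add ht ht'))
    linarith
  have hp : IsSublinear fun g => sInf (S g) := by
    refine ⟨fun g h => ?_, fun k g => ?_⟩
    · rw [← csInf_add (hne g) (hbdd g) (hne h) (hbdd h)]
      exact csInf_le_csInf (hbdd _) ((hne g).add (hne h)) (hadd g h)
    · rcases Nat.eq_zero_or_pos k with rfl | hk
      · simp only [zero_smul, Nat.cast_zero, zero_mul]
        refine le_antisymm (csInf_le (hbdd 0) ⟨1, 0, one_pos, by simp, by simp⟩)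
          (le_csInf (hne 0) hzero)
      · have : S (k • g) = (k : ℝ) • S g := by
          have hk' : (k : ℝ) ≠ 0 := by positivity
          ext t
          rw [Set.mem_smul_set]
          constructor
          · rintro ⟨n, m, hn, hm, rfl⟩
            refine ⟨_, ⟨n * k, m, Nat.mul_pos hn hk, ?_, rfl⟩, ?_⟩
            · rwa [mul_smul]
            · have : (n : ℝ) ≠ 0 := by positivity
              push_cast
              rw [smul_eq_mul]
              field_simp
          · rintro ⟨_, ⟨n, m, hn, hm, rfl⟩, rfl⟩
            refine ⟨n, k * m, hn, ?_, ?_⟩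
            · have := hsmul k hm
              rwa [smul_sub, smul_smul, natCast_zsmul, smul_comm k n g] at this
            · push_cast
              rw [smul_eq_mul, mul_div_assoc]
        rw [this, Real.sInf_smul_of_nonneg (Nat.cast_nonneg k), smul_eq_mul]
  obtain ⟨f, hf, hfg⟩ := hp.exists_addMonoidHom_le g₀
  refine ⟨f, fun k hk => ?_, le_antisymm ?_ ?_, ?_⟩
  · have := (hf (-k)).trans (csInf_le (hbdd _) ⟨1, 0, one_pos, by simpa using hk, rfl⟩)
    rw [map_neg] at this
    simpa using this
  · exact (hf u).trans (csInf_le (hbdd _) ⟨1, 1, one_pos, by simp, by simp⟩)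
  · have := (hf (-u)).trans (csInf_le (hbdd _) ⟨1, -1, one_pos, by simp, rfl⟩)
    rw [map_neg] at this
    norm_num at this
    linarith
  · rw [hfg]
    refine le_csInf (hne _) ?_
    rintro _ ⟨n, m, hn, hm, rfl⟩
    rw [le_div_iff₀ (by positivity)]
    by_contra! hlt
    exact hcon n m hn hlt hm

/-- For elements `x`, `y` of a positively ordered monoid with order unit `u`, either some
normalized state `f` has `f y ≤ f x + r`, or some stable multiple of `x` plus a large multiple of
`u` lies below the same multiple of `y`. -/
theorem exists_state_or {W : Type*} [AddCommMonoid W] [PartialOrder W] [IsOrderedAddMonoid W]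
    (u : W) (h0 : ∀ x : W, 0 ≤ x) (hu : ∀ x : W, ∃ N : ℕ, x ≤ N • u) (x y : W) (r : ℝ)
    (hr : 0 ≤ r) :
    (∃ f : W →+ ℝ, Monotone f ∧ f u = 1 ∧ f y ≤ f x + r) ∨
      ∃ n s : ℕ, 0 < n ∧ r * n < s ∧ ∃ z, n • x + s • u + z ≤ n • y + z := by
  let ι : W →+ Algebra.GrothendieckAddGroup W := Algebra.GrothendieckAddGroup.of
  have hι : ∀ {a b : W}, ι a = ι b ↔ ∃ c : W, a + c = b + c := by
    intro a b
    have := (AddLocalization.addMonoidOf (⊤ : AddSubmonoid W)).eq_iff_exists (x := a) (y := b)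
    refine this.trans ⟨?_, ?_⟩
    · rintro ⟨c, hc⟩
      exact ⟨c, by rwa [add_comm a, add_comm b]⟩
    · rintro ⟨c, hc⟩
      exact ⟨⟨c, trivial⟩, by rwa [add_comm (c : W) a, add_comm (c : W) b]⟩
  have hsurj : ∀ g, ∃ a b : W, g = ι b - ι a := by
    intro g
    obtain ⟨⟨b, a⟩, h⟩ := (AddLocalization.addMonoidOf (⊤ : AddSubmonoid W)).surj g
    exact ⟨a, b, eq_sub_of_add_eq h⟩
  let K : AddSubmonoid (Algebra.GrothendieckAddGroup W) :=
    { carrier := {g | ∃ a b : W, a ≤ b ∧ g = ι b - ι a}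
      zero_mem' := ⟨0, 0, le_rfl, by simp⟩
      add_mem' := by
        rintro _ _ ⟨a, b, hab, rfl⟩ ⟨a', b', hab', rfl⟩
        exact ⟨a + a', b + b', add_le_add hab hab', by simp only [map_add]; abel⟩ }
  have hK : ∀ {a b : W}, ι b - ι a ∈ K ↔ ∃ z, a + z ≤ b + z := by
    intro a b
    constructor
    · rintro ⟨a', b', hab, h⟩
      rw [sub_eq_sub_iff_add_eq_add, ← map_add, ← map_add, hι] at h
      obtain ⟨c, hc⟩ := h
      refine ⟨a' + c, ?_⟩
      calc a + (a' + c) ≤ a + (b' + c) := by gcongr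
        _ = b' + a + c := by abel
        _ = b + (a' + c) := by rw [← hc]; abel
    · rintro ⟨z, hz⟩
      exact ⟨_, _, hz, by simp only [map_add]; abel⟩
  have hunit : ∀ g, ∃ N : ℕ, N • ι u - g ∈ K := by
    intro g
    obtain ⟨a, b, rfl⟩ := hsurj g
    obtain ⟨N, hN⟩ := hu b
    refine ⟨N, b, N • u + a, hN.trans (le_add_of_nonneg_right (h0 a)), ?_⟩
    simp only [map_add, map_nsmul]
    abel
  rcases exists_positive_functional_or K (ι u) hunit (ι x - ι y) (-r) with
    ⟨f, hf, hfu, hfx⟩ | ⟨n, m, hn, hm, hmem⟩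
  · left
    refine ⟨f.comp ι, fun a b hab => ?_, hfu, ?_⟩
    · have := hf (ι b - ι a) ⟨a, b, hab, rfl⟩
      rw [map_sub] at this
      simpa using this
    · rw [map_sub] at hfx
      simp only [AddMonoidHom.comp_apply]
      linarith
  · right
    have hm0 : m < 0 := by
      have h1 : (m : ℝ) < 0 := hm.trans_le (by nlinarith [Nat.cast_nonneg (α := ℝ) n])
      exact_mod_cast h1
    obtain ⟨s, hs⟩ := Int.eq_ofNat_of_zero_le (neg_nonneg.mpr hm0.le)
    obtain rfl : m = -(s : ℤ) := by omega
    refine ⟨n, s, hn, ?_, ?_⟩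
    · push_cast at hm
      linarith
    · rw [← hK]
      convert hmem using 1
      simp only [map_add, map_nsmul, smul_sub, neg_smul, natCast_zsmul]
      abel

/-- Cancellation of `z` after passing to large multiples. -/
lemma exists_nsmul_le_of_add_le_add {W : Type*} [AddCommMonoid W] [PartialOrder W]
    [IsOrderedAddMonoid W] (h0 : ∀ x : W, 0 ≤ x) {a b z : W} (h : a + z ≤ b + z) (k : ℕ) :
    k • a ≤ k • b + z := by
  -- The same z serves as catalyst for every copy of a, so its multiplicity does not grow with k.
  have : ∀ k : ℕ, k • a + z ≤ k • b + z := by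
    intro k
    induction k with
    | zero => simp
    | succ k ih =>
      calc (k + 1) • a + z = k • a + (a + z) := by rw [succ_nsmul]; abel
        _ ≤ k • a + (b + z) := by gcongr
        _ = k • a + z + b := by abel
        _ ≤ k • b + z + b := by gcongr
        _ = (k + 1) • b + z := by rw [succ_nsmul]; abel
  exact (le_add_of_nonneg_right (h0 z)).trans (this k)

end States

/-! ### Cuntz comparison and the elements (a - ε)₊ in a C*-algebra. -/

section CStarAlgebra

variable {B : Type*} [CStarAlgebra B]

lemma isSelfAdjoint_sub_algebraMap {a : B} (ha : IsSelfAdjoint a) (ε : ℝ) :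
    IsSelfAdjoint (a - algebraMap ℝ B ε) :=
  ha.sub (IsSelfAdjoint.algebraMap B (IsSelfAdjoint.all ε))

variable [PartialOrder B] [StarOrderedRing B]

lemma algebraMap_real_eq_smul_one (ε : ℝ) : algebraMap ℝ B ε = (ε : ℂ) • (1 : B) := by
  rw [IsScalarTower.algebraMap_apply ℝ ℂ B, Algebra.algebraMap_eq_smul_one]
  rfl

lemma exists_eq_star_mul_self_of_nonneg {b : B} (hb : 0 ≤ b) : ∃ s : B, b = star s * s :=
  CStarAlgebra.nonneg_iff_eq_star_mul_self.mp hb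

/-- If `0 ≤ x ≤ y`, then `x` is Cuntz subequivalent to `y`. -/
lemma exists_norm_star_mul_mul_sub_lt_of_le {x y : B} (hx : 0 ≤ x) (hxy : x ≤ y) {ε : ℝ}
    (hε : 0 < ε) : ∃ v : B, ‖star v * y * v - x‖ < ε := by
  have hy : 0 ≤ y := hx.trans hxy
  set η : ℝ := ε / 2 with hη
  have hη0 : 0 < η := by positivity
  -- As z is invertible, v = z^(-1/2) x^(1/2) satisfies v* z v = x exactly. Also ‖v‖ ≤ 1 because x ≤
  -- z, so replacing z by y costs at most η.
  set z : B := y + algebraMap ℝ B η with hz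
  have hη' : IsStrictlyPositive (algebraMap ℝ B η) := by
    refine IsUnit.isStrictlyPositive ?_ ?_
    · exact (IsUnit.mk0 η hη0.ne').map (algebraMap ℝ B)
    · exact algebraMap_nonneg B hη0.le
  have hzpos : IsStrictlyPositive z := hη'.of_le (by simpa [hz] using hy)
  have hxz : x ≤ z := hxy.trans (by simpa [hz] using hη'.nonneg)
  set s : B := z ^ (-(1 / 2) : ℝ) with hs
  have hs_sa : star s = s := (IsSelfAdjoint.of_nonneg CFC.rpow_nonneg : IsSelfAdjoint s)
  have hszs : s * z * s = 1 := CFC.conjugate_rpow_neg_one_half z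
  set t : B := CFC.sqrt x with ht
  have ht_sa : star t = t := (IsSelfAdjoint.of_nonneg (CFC.sqrt_nonneg x) : IsSelfAdjoint t)
  have htt : t * t = x := CFC.sqrt_mul_sqrt_self x
  have hnorm : ‖s * t‖ ≤ 1 := by
    have := (le_iff_norm_sqrt_mul_rpow x z).mp hxz
    rw [← norm_star, star_mul, hs_sa, ht_sa]
    exact this
  refine ⟨s * t, ?_⟩
  have h1 : star (s * t) * y * (s * t) - x = -(η • (star (s * t) * (s * t))) := by
    have h2 : y = z - algebraMap ℝ B η := by simp [hz]
    have h3 : star (s * t) * z * (s * t) = x := by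
      rw [star_mul, hs_sa, ht_sa]
      calc t * s * z * (s * t) = t * (s * z * s) * t := by simp only [mul_assoc]
        _ = x := by rw [hszs, mul_one, htt]
    rw [h2, mul_sub, sub_mul, h3, Algebra.algebraMap_eq_smul_one]
    simp
  rw [h1, norm_neg, norm_smul, CStarRing.norm_star_mul_self, Real.norm_of_nonneg hη0.le]
  have h2 : ‖s * t‖ * ‖s * t‖ ≤ 1 := mul_le_one₀ hnorm (norm_nonneg _) hnorm
  have h3 := mul_le_mul_of_nonneg_left h2 hη0.le
  linarith

/-- A positive element is Cuntz subequivalent to its cube. -/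
lemma exists_norm_star_mul_cube_mul_sub_lt {p : B} (hp : 0 ≤ p) {ε : ℝ} (hε : 0 < ε) :
    ∃ v : B, ‖star v * (p * p * p) * v - p‖ < ε := by
  set η : ℝ := ε / 4 with hη
  have hη0 : 0 < η := by positivity
  have hspec : ∀ x ∈ spectrum ℝ p, 0 ≤ x := fun x hx => spectrum_nonneg_of_nonneg hp hx
  have hcont : ContinuousOn (fun x : ℝ => (x + η)⁻¹) (spectrum ℝ p) := by
    refine ContinuousOn.inv₀ (by fun_prop) fun x hx => ?_
    have := hspec x hx
    positivity
  have hpsa : IsSelfAdjoint p := .of_nonneg hp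
  -- The error x - x³/(x + η)² lies between 0 and 3η < ε on the spectrum.
  refine ⟨cfc (fun x : ℝ => (x + η)⁻¹) p, ?_⟩
  have hsa : star (cfc (fun x : ℝ => (x + η)⁻¹) p) = cfc (fun x : ℝ => (x + η)⁻¹) p :=
    (cfc_predicate _ p : IsSelfAdjoint _)
  have hid : p = cfc (fun x : ℝ => x) p := (cfc_id' ℝ p).symm
  have hcube : p * p * p = cfc (fun x : ℝ => x * x * x) p := by
    rw [cfc_mul (fun x : ℝ => x * x) (fun x : ℝ => x) p,
      cfc_mul (fun x : ℝ => x) (fun x : ℝ => x) p, ← hid]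
  have key : star (cfc (fun x : ℝ => (x + η)⁻¹) p) * (p * p * p) *
      cfc (fun x : ℝ => (x + η)⁻¹) p - p = cfc (fun x : ℝ => (x + η)⁻¹ * (x * x * x) * (x + η)⁻¹ - x) p := by
    rw [hsa, hcube, cfc_sub (fun x : ℝ => (x + η)⁻¹ * (x * x * x) * (x + η)⁻¹) (fun x : ℝ => x) p
      (by fun_prop) (by fun_prop), cfc_mul (fun x : ℝ => (x + η)⁻¹ * (x * x * x))
      (fun x : ℝ => (x + η)⁻¹) p (by fun_prop) hcont, cfc_mul (fun x : ℝ => (x + η)⁻¹)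
      (fun x : ℝ => x * x * x) p hcont (by fun_prop), ← hid]
  rw [key]
  refine lt_of_le_of_lt (norm_cfc_le (c := 3 * η) (by positivity) fun x hx => ?_) (by linarith)
  have hx0 := hspec x hx
  have hxη : 0 < x + η := by positivity
  have : (x + η)⁻¹ * (x * x * x) * (x + η)⁻¹ - x = -((x * (2 * x * η + η ^ 2)) / (x + η) ^ 2) := by
    field_simp
    ring
  rw [this, norm_neg, Real.norm_of_nonneg (by positivity), div_le_iff₀ (by positivity)]
  have h3 : 0 ≤ η * x ^ 2 := by positivity
  have h4 : 0 ≤ x * η ^ 2 := by positivity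
  have h5 : 0 ≤ η ^ 3 := by positivity
  nlinarith

lemma exists_star_mul_mul_eq_one_of_norm_sub_one_lt {g : B} (hg : 0 ≤ g) (h : ‖g - 1‖ < 1) :
    ∃ y : B, star y * g * y = 1 := by
  have hunit : IsUnit g := by
    have := isUnit_one_sub_of_norm_lt_one (x := 1 - g) (by rwa [norm_sub_rev])
    rwa [sub_sub_cancel] at this
  have hpos : IsStrictlyPositive g := hunit.isStrictlyPositive hg
  refine ⟨g ^ (-(1 / 2) : ℝ), ?_⟩
  rw [(IsSelfAdjoint.of_nonneg CFC.rpow_nonneg : star (g ^ (-(1 / 2) : ℝ)) = _)]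
  exact CFC.conjugate_rpow_neg_one_half g

/-- The element `(a - ε)₊` of a C*-algebra. -/
noncomputable def cutDown (a : B) (ε : ℝ) : B := (a - algebraMap ℝ B ε)⁺

lemma cutDown_nonneg (a : B) (ε : ℝ) : 0 ≤ cutDown a ε := CFC.posPart_nonneg _

/-- Uniqueness of the decomposition into orthogonal positive parts; it lets cut-downs be computed
under homomorphisms and block sums algebraically. -/
lemma cutDown_eq_of_eq_sub {a p q : B} {ε : ℝ} (h : a - algebraMap ℝ B ε = p - q)
    (hpq : p * q = 0) (hp : 0 ≤ p) (hq : 0 ≤ q) : cutDown a ε = p :=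
  (CFC.posPart_negPart_unique h hpq hp hq).1

lemma exists_cutDown_eq_sub {a : B} (ha : IsSelfAdjoint a) (ε : ℝ) :
    ∃ q : B, 0 ≤ q ∧ a - algebraMap ℝ B ε = cutDown a ε - q ∧ cutDown a ε * q = 0 :=
  ⟨_, CFC.negPart_nonneg _,
    (CFC.posPart_sub_negPart _ (isSelfAdjoint_sub_algebraMap ha ε)).symm,
    CFC.posPart_mul_negPart _⟩

lemma norm_cutDown_sub_le {a : B} (ha : 0 ≤ a) {ε : ℝ} (hε : 0 ≤ ε) :
    ‖cutDown a ε - a‖ ≤ ε := by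
  have hsa : IsSelfAdjoint a := .of_nonneg ha
  have h0 : a - algebraMap ℝ B ε = cfc (fun x : ℝ => x - ε) a := by
    rw [cfc_sub (fun x : ℝ => x) (fun _ => ε) a, cfc_id' ℝ a, cfc_const ε a]
  have h1 : cutDown a ε = cfc (fun x : ℝ => (x - ε)⁺) a := by
    rw [cutDown, h0, CFC.posPart_def, cfcₙ_eq_cfc, ← cfc_comp' (fun x : ℝ => x⁺) (fun x => x - ε) a]
  have h2 : cutDown a ε - a = cfc (fun x : ℝ => (x - ε)⁺ - x) a := by
    rw [cfc_sub (fun x : ℝ => (x - ε)⁺) (fun x => x) a, cfc_id' ℝ a, h1]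
  rw [h2]
  refine norm_cfc_le hε fun x hx => ?_
  have hx0 : 0 ≤ x := spectrum_nonneg_of_nonneg ha hx
  rw [Real.norm_eq_abs, abs_le, posPart_def]
  rcases le_total (x - ε) 0 with h | h
  · rw [sup_eq_right.mpr h]
    constructor <;> linarith
  · rw [sup_eq_left.mpr h]
    constructor <;> linarith

lemma map_cutDown {C : Type*} [CStarAlgebra C] [PartialOrder C] [StarOrderedRing C]
    (φ : C →⋆ₐ[ℂ] B) {a : C} (ha : IsSelfAdjoint a) (ε : ℝ) :
    φ (cutDown a ε) = cutDown (φ a) ε := by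
  obtain ⟨q, hq, h, hpq⟩ := exists_cutDown_eq_sub ha ε
  refine (cutDown_eq_of_eq_sub (q := φ q) ?_ ?_ ?_ ?_).symm
  · have hε : φ (algebraMap ℝ C ε) = algebraMap ℝ B ε := by
      rw [IsScalarTower.algebraMap_apply ℝ ℂ C, IsScalarTower.algebraMap_apply ℝ ℂ B]
      exact AlgHomClass.commutes φ _
    rw [← map_sub, ← h, map_sub, hε]
  · rw [← map_mul, hpq, map_zero]
  · exact map_nonneg φ (cutDown_nonneg a ε)
  · exact map_nonneg φ hq

lemma cutDown_one {ε : ℝ} (hε : ε ≤ 1) :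
    cutDown (1 : B) ε = algebraMap ℝ B (1 - ε) := by
  rw [cutDown, ← map_one (algebraMap ℝ B), ← map_sub]
  exact (CFC.posPart_eq_self _).mpr (algebraMap_nonneg B (by linarith))

lemma exists_star_mul_cutDown_one_mul_eq_one {ε : ℝ} (hε : ε < 1) :
    ∃ v : B, star v * cutDown (1 : B) ε * v = 1 := by
  have h1 : 0 < 1 - ε := by linarith
  refine ⟨algebraMap ℝ B √((1 - ε)⁻¹), ?_⟩
  have hsa : star (algebraMap ℝ B √((1 - ε)⁻¹)) = algebraMap ℝ B √((1 - ε)⁻¹) :=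
    IsSelfAdjoint.algebraMap B (IsSelfAdjoint.all _)
  rw [cutDown_one hε.le, hsa, ← map_mul, ← map_mul, mul_right_comm,
    Real.mul_self_sqrt (by positivity), inv_mul_cancel₀ h1.ne', map_one]

/-- If `‖a - b‖ ≤ ε`, then `(a - ε)₊` is Cuntz subequivalent to `b`. -/
lemma exists_norm_star_mul_mul_sub_cutDown_lt {a b : B} (ha : IsSelfAdjoint a)
    (hb : IsSelfAdjoint b) {ε : ℝ} (hab : ‖a - b‖ ≤ ε) {η : ℝ} (hη : 0 < η) :
    ∃ v : B, ‖star v * b * v - cutDown a ε‖ < η := by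
  set p := cutDown a ε with hp_def
  have hp : 0 ≤ p := cutDown_nonneg a ε
  have hpsa : IsSelfAdjoint p := .of_nonneg hp
  obtain ⟨q, hq, h, hpq⟩ := exists_cutDown_eq_sub ha ε
  -- Compressing this by p = (a - ε)₊ gives p³ ≤ p b p, whence p ≾ p³ ≾ p b p ≾ b.
  have hle : a - algebraMap ℝ B ε ≤ b := by
    have h1 : a - b ≤ algebraMap ℝ B ‖a - b‖ := IsSelfAdjoint.le_algebraMap_norm_self (ha.sub hb)
    have h2 : algebraMap ℝ B ‖a - b‖ ≤ algebraMap ℝ B ε := algebraMap_mono B hab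
    have h3 := h1.trans h2
    rw [sub_le_iff_le_add] at h3 ⊢
    rwa [add_comm]
  have hcube : p * p * p ≤ p * b * p := by
    have h1 : p * (a - algebraMap ℝ B ε) * p = p * p * p := by
      rw [h, mul_sub, hpq, sub_zero]
    rw [← h1]
    exact hpsa.conjugate_le_conjugate hle
  have hcube0 : 0 ≤ p * p * p := hpsa.conjugate_nonneg hp
  obtain ⟨w, hw⟩ := exists_norm_star_mul_cube_mul_sub_lt hp (half_pos hη)
  have hw1 : 0 < ‖w‖ ^ 2 + 1 := by positivity
  obtain ⟨v, hv⟩ := exists_norm_star_mul_mul_sub_lt_of_le hcube0 hcube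
    (div_pos (half_pos hη) hw1)
  refine ⟨p * v * w, ?_⟩
  have hpp : star p = p := hpsa
  have h1 : star (p * v * w) * b * (p * v * w) - p =
      star w * (star v * (p * b * p) * v - p * p * p) * w + (star w * (p * p * p) * w - p) := by
    simp only [star_mul, hpp, mul_sub, sub_mul, mul_assoc]
    abel
  rw [h1]
  refine (norm_add_le _ _).trans_lt ?_
  have h2 : ‖star w * (star v * (p * b * p) * v - p * p * p) * w‖ ≤ η / 2 := by
    refine (norm_mul_le _ _).trans ?_
    refine (mul_le_mul_of_nonneg_right (norm_mul_le _ _) (norm_nonneg _)).trans ?_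
    rw [norm_star]
    rw [lt_div_iff₀ hw1] at hv
    nlinarith [norm_nonneg (star v * (p * b * p) * v - p * p * p)]
  linarith

end CStarAlgebra

/-! ### Cuntz subequivalence of matrices. -/

section CuntzSub

variable {A : Type*} [CStarAlgebra A] [PartialOrder A] [StarOrderedRing A]
variable {ι κ μ ν : Type*} [Fintype ι] [Fintype κ] [Fintype μ] [Fintype ν]

namespace CStarMatrix

lemma continuous_rect_mul {X : Type*} [TopologicalSpace X] {f : X → CStarMatrix ι κ A}
    {g : X → CStarMatrix κ μ A} (hf : Continuous f) (hg : Continuous g) :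
    Continuous fun x => f x * g x :=
  Continuous.matrix_mul (m := ι) (n := κ) (p := μ) (A := f) (B := g) hf hg

lemma continuous_conjTranspose {X : Type*} [TopologicalSpace X] {f : X → CStarMatrix ι κ A}
    (hf : Continuous f) : Continuous fun x => (f x).conjTranspose :=
  Continuous.matrix_conjTranspose (A := f) hf

lemma rect_mul_assoc (a : CStarMatrix ι κ A) (b : CStarMatrix κ μ A) (c : CStarMatrix μ ν A) :
    a * b * c = a * (b * c) := Matrix.mul_assoc a b c

lemma conjTranspose_rect_mul (a : CStarMatrix ι κ A) (b : CStarMatrix κ μ A) :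
    (a * b).conjTranspose = b.conjTranspose * a.conjTranspose :=
  Matrix.conjTranspose_mul a b

lemma conjTranspose_mul_self_nonneg (x : CStarMatrix κ ι A) : 0 ≤ x.conjTranspose * x := by
  classical
  rcases isEmpty_or_nonempty ι with hι | ⟨⟨j₀⟩⟩
  · exact le_of_eq (by ext i; exact hι.elim i)
  -- Each row of x is placed in a square matrix, where star squares are known to be positive.
  let R : κ → CStarMatrix ι ι A := fun i => ofMatrix fun j k => if j = j₀ then x i k else 0
  have hR : ∀ i j k, R i j k = if j = j₀ then x i k else 0 := fun _ _ _ => rfl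
  have : x.conjTranspose * x = ∑ i, star (R i) * R i := by
    ext k l
    rw [CStarMatrix.mul_apply]
    have : (∑ i, star (R i) * R i) k l = ∑ i, (star (R i) * R i) k l := by
      exact Matrix.sum_apply k l Finset.univ _
    rw [this]
    refine Finset.sum_congr rfl fun i _ => ?_
    rw [CStarMatrix.mul_apply, Finset.sum_eq_single j₀]
    · simp [hR, star_apply]
    · intro j _ hj
      simp [hR, star_apply, hj]
    · simp
  rw [this]
  exact Finset.sum_nonneg fun i _ => star_mul_self_nonneg _

lemma conjTranspose_mul_mul_nonneg {b : CStarMatrix κ κ A} (hb : 0 ≤ b) (v : CStarMatrix κ ι A) :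
    0 ≤ v.conjTranspose * b * v := by
  classical
  obtain ⟨s, rfl⟩ := exists_eq_star_mul_self_of_nonneg hb
  have := conjTranspose_mul_self_nonneg (s * v)
  rw [conjTranspose_rect_mul, rect_mul_assoc, ← rect_mul_assoc _ s v] at this
  rw [rect_mul_assoc]
  exact this

end CStarMatrix

/-- Cuntz subequivalence of square matrices over arbitrary finite index types. -/
def CuntzSub (a : CStarMatrix ι ι A) (b : CStarMatrix κ κ A) : Prop :=
  ∀ ε : ℝ, 0 < ε → ∃ v : CStarMatrix κ ι A, ‖v.conjTranspose * b * v - a‖ < ε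

lemma cuntzLE_iff_cuntzSub {n m : ℕ} {a : CStarMatrix (Fin n) (Fin n) A}
    {b : CStarMatrix (Fin m) (Fin m) A} : CuntzLE a b ↔ CuntzSub a b := Iff.rfl

namespace CuntzSub

variable {a a' : CStarMatrix ι ι A} {b b' : CStarMatrix κ κ A} {c : CStarMatrix μ μ A}

lemma of_eq {v : CStarMatrix κ ι A} (h : v.conjTranspose * b * v = a) : CuntzSub a b :=
  fun ε hε => ⟨v, by simpa [h] using hε⟩

lemma of_forall_near (h : ∀ ε : ℝ, 0 < ε → ∃ y : CStarMatrix ι ι A, ‖y - a‖ < ε ∧ CuntzSub y b) :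
    CuntzSub a b := by
  intro ε hε
  obtain ⟨y, hy, hyb⟩ := h (ε / 2) (half_pos hε)
  obtain ⟨v, hv⟩ := hyb (ε / 2) (half_pos hε)
  refine ⟨v, ?_⟩
  have := norm_add_le (v.conjTranspose * b * v - y) (y - a)
  rw [sub_add_sub_cancel] at this
  linarith

/-- Conjugation by the 0-1 matrix of f; this handles every reindexing and passage to corners. -/
lemma of_entries (f : ι → κ) (h : ∀ i j, a i j = b (f i) (f j)) : CuntzSub a b := by
  classical
  let v : CStarMatrix κ ι A := CStarMatrix.ofMatrix fun k i => if k = f i then 1 else 0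
  have hv : ∀ k i, v k i = if k = f i then 1 else 0 := fun _ _ => rfl
  refine of_eq (v := v) ?_
  ext i j
  simp [CStarMatrix.mul_apply, h, hv, apply_ite star]

lemma refl (a : CStarMatrix ι ι A) : CuntzSub a a := of_entries id fun _ _ => rfl

lemma conj (v : CStarMatrix κ ι A) (b : CStarMatrix κ κ A) :
    CuntzSub (v.conjTranspose * b * v) b := of_eq rfl

/-- If `a` is Cuntz subequivalent to `b`, then a single matrix `v` conjugates all matrices near `b`
to matrices near `a`. -/
lemma exists_pos_near (h : CuntzSub a b) {ε : ℝ} (hε : 0 < ε) :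
    ∃ v : CStarMatrix κ ι A, ∃ δ > 0, ∀ b' : CStarMatrix κ κ A, ‖b' - b‖ < δ →
      ‖v.conjTranspose * b' * v - a‖ < ε := by
  obtain ⟨v, hv⟩ := h ε hε
  have hcont : Continuous fun w : CStarMatrix κ κ A => ‖v.conjTranspose * w * v - a‖ :=
    ((CStarMatrix.continuous_rect_mul (CStarMatrix.continuous_rect_mul continuous_const
      continuous_id) continuous_const).sub continuous_const).norm
  obtain ⟨δ, hδ, hball⟩ := Metric.eventually_nhds_iff.mp
    (hcont.continuousAt.eventually_lt continuousAt_const hv)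
  exact ⟨v, δ, hδ, fun b' hb' => hball (by rwa [dist_eq_norm])⟩

lemma trans (h : CuntzSub a b) (h' : CuntzSub b c) : CuntzSub a c := by
  intro ε hε
  obtain ⟨v, δ, hδ, hv⟩ := h.exists_pos_near hε
  obtain ⟨w, hw⟩ := h' δ hδ
  refine ⟨w * v, ?_⟩
  have := hv _ hw
  rw [CStarMatrix.conjTranspose_rect_mul]
  simpa only [CStarMatrix.rect_mul_assoc] using this

variable [DecidableEq ι] [DecidableEq κ]

lemma of_le {a b : CStarMatrix ι ι A} (ha : 0 ≤ a) (hab : a ≤ b) : CuntzSub a b :=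
  fun _ hε => exists_norm_star_mul_mul_sub_lt_of_le ha hab hε

lemma cutDown_of_norm_sub_le {a b : CStarMatrix ι ι A} (ha : 0 ≤ a) (hb : 0 ≤ b) {ε : ℝ}
    (hab : ‖a - b‖ ≤ ε) : CuntzSub (cutDown a ε) b :=
  fun _ hη => exists_norm_star_mul_mul_sub_cutDown_lt (.of_nonneg ha) (.of_nonneg hb) hab hη

lemma cutDown_self {a : CStarMatrix ι ι A} (ha : 0 ≤ a) {ε : ℝ} (hε : 0 ≤ ε) :
    CuntzSub (cutDown a ε) a :=
  cutDown_of_norm_sub_le ha ha (by simpa using hε)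

/-- The conjugating v for a ≾ b tolerates a small cut-down of b. This is what makes the regularized
dimension function monotone. -/
lemma exists_cutDown (h : CuntzSub a b) (ha : 0 ≤ a) (hb : 0 ≤ b) {ε : ℝ} (hε : 0 < ε) :
    ∃ δ > 0, CuntzSub (cutDown a ε) (cutDown b δ) := by
  obtain ⟨v, δ, hδ, hv⟩ := h.exists_pos_near hε
  have h1 := hv (cutDown b (δ / 2))
    ((norm_cutDown_sub_le hb (half_pos hδ).le).trans_lt (half_lt_self hδ))
  refine ⟨δ / 2, half_pos hδ, ?_⟩
  refine (cutDown_of_norm_sub_le ha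
    (CStarMatrix.conjTranspose_mul_mul_nonneg (cutDown_nonneg b _) v) ?_).trans (conj v _)
  rw [norm_sub_rev]
  exact h1.le

end CuntzSub

end CuntzSub

/-! ### Block sums and multiples of matrices. -/

section Blocks

variable {A : Type*} [CStarAlgebra A] [PartialOrder A] [StarOrderedRing A]
variable {ι κ μ ν : Type*} [Fintype ι] [Fintype κ] [Fintype μ] [Fintype ν]

/-- The rectangular block diagonal matrix with blocks `a` and `b`. -/
def blockSum (a : CStarMatrix ι μ A) (b : CStarMatrix κ ν A) : CStarMatrix (ι ⊕ κ) (μ ⊕ ν) A :=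
  CStarMatrix.ofMatrix (Matrix.fromBlocks (CStarMatrix.ofMatrix.symm a) 0 0
    (CStarMatrix.ofMatrix.symm b))

section entries

variable (a : CStarMatrix ι μ A) (b : CStarMatrix κ ν A)

@[simp] lemma blockSum_inl_inl (i : ι) (j : μ) : blockSum a b (.inl i) (.inl j) = a i j := rfl
@[simp] lemma blockSum_inr_inr (i : κ) (j : ν) : blockSum a b (.inr i) (.inr j) = b i j := rfl
@[simp] lemma blockSum_inl_inr (i : ι) (j : ν) : blockSum a b (.inl i) (.inr j) = 0 := rfl
@[simp] lemma blockSum_inr_inl (i : κ) (j : μ) : blockSum a b (.inr i) (.inl j) = 0 := rfl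

end entries

lemma blockSum_mul {ρ σ : Type*} (a : CStarMatrix ι μ A) (b : CStarMatrix κ ν A)
    (c : CStarMatrix μ ρ A) (d : CStarMatrix ν σ A) :
    blockSum a b * blockSum c d = blockSum (a * c) (b * d) := by
  ext (i | i) (j | j) <;> simp [CStarMatrix.mul_apply]

lemma blockSum_sub (a a' : CStarMatrix ι μ A) (b b' : CStarMatrix κ ν A) :
    blockSum a b - blockSum a' b' = blockSum (a - a') (b - b') := by
  ext (i | i) (j | j) <;> simp

lemma blockSum_zero : blockSum (0 : CStarMatrix ι μ A) (0 : CStarMatrix κ ν A) = 0 := by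
  ext (i | i) (j | j) <;> simp

lemma conjTranspose_blockSum (a : CStarMatrix ι μ A) (b : CStarMatrix κ ν A) :
    (blockSum a b).conjTranspose = blockSum a.conjTranspose b.conjTranspose := by
  ext (i | i) (j | j) <;> simp

lemma continuous_blockSum {X : Type*} [TopologicalSpace X] {f : X → CStarMatrix ι μ A}
    {g : X → CStarMatrix κ ν A} (hf : Continuous f) (hg : Continuous g) :
    Continuous fun x => blockSum (f x) (g x) :=
  Continuous.matrix_fromBlocks hf continuous_const continuous_const hg

lemma blockSum_nonneg {a : CStarMatrix ι ι A} {b : CStarMatrix κ κ A} (ha : 0 ≤ a) (hb : 0 ≤ b) :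
    0 ≤ blockSum a b := by
  classical
  obtain ⟨s, rfl⟩ := exists_eq_star_mul_self_of_nonneg ha
  obtain ⟨t, rfl⟩ := exists_eq_star_mul_self_of_nonneg hb
  have h := CStarMatrix.conjTranspose_mul_self_nonneg (blockSum s t)
  rw [conjTranspose_blockSum, blockSum_mul] at h
  exact h

lemma CuntzSub.blockSum {ι' κ' : Type*} [Fintype ι'] [Fintype κ'] {a : CStarMatrix ι ι A}
    {b : CStarMatrix κ κ A} {a' : CStarMatrix ι' ι' A} {b' : CStarMatrix κ' κ' A}
    (ha : CuntzSub a a') (hb : CuntzSub b b') :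
    CuntzSub (_root_.blockSum a b) (_root_.blockSum a' b') := by
  intro ε hε
  have hcont : Continuous fun w : CStarMatrix ι ι A × CStarMatrix κ κ A =>
      _root_.blockSum w.1 w.2 := continuous_blockSum continuous_fst continuous_snd
  obtain ⟨δ, hδ, hball⟩ := Metric.continuousAt_iff.mp (hcont.continuousAt (x := (a, b))) ε hε
  obtain ⟨v, hv⟩ := ha δ hδ
  obtain ⟨w, hw⟩ := hb δ hδ
  refine ⟨_root_.blockSum v w, ?_⟩
  have := @hball (v.conjTranspose * a' * v, w.conjTranspose * b' * w) (by
    rw [Prod.dist_eq, max_lt_iff, dist_eq_norm, dist_eq_norm]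
    exact ⟨hv, hw⟩)
  rw [dist_eq_norm] at this
  rwa [conjTranspose_blockSum, blockSum_mul, blockSum_mul]

lemma cutDown_blockSum [DecidableEq ι] [DecidableEq κ] {a : CStarMatrix ι ι A}
    {b : CStarMatrix κ κ A} (ha : 0 ≤ a) (hb : 0 ≤ b) (ε : ℝ) :
    cutDown (blockSum a b) ε = blockSum (cutDown a ε) (cutDown b ε) := by
  obtain ⟨p, hp, hap, hp0⟩ := exists_cutDown_eq_sub (.of_nonneg ha) ε
  obtain ⟨q, hq, hbq, hq0⟩ := exists_cutDown_eq_sub (.of_nonneg hb) ε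
  refine cutDown_eq_of_eq_sub (q := blockSum p q) ?_ ?_
    (blockSum_nonneg (cutDown_nonneg _ _) (cutDown_nonneg _ _)) (blockSum_nonneg hp hq)
  · rw [blockSum_sub, ← hap, ← hbq, ← blockSum_sub]
    congr 1
    rw [algebraMap_real_eq_smul_one, algebraMap_real_eq_smul_one, algebraMap_real_eq_smul_one]
    ext (i | i) (j | j) <;> simp [CStarMatrix.one_apply, -Complex.coe_smul]
  · refine (blockSum_mul _ _ _ _).trans ?_
    rw [← blockSum_zero]
    exact congrArg₂ _ hp0 hq0

/-- The block diagonal matrix with all diagonal blocks equal to `a`. -/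
def replicate (ο : Type*) [DecidableEq ο] (a : CStarMatrix ι κ A) :
    CStarMatrix (ο × ι) (ο × κ) A :=
  CStarMatrix.ofMatrix fun p q => if p.1 = q.1 then a p.2 q.2 else 0

section replicate

variable {ο : Type*} [DecidableEq ο] [Fintype ο]

lemma replicate_apply (a : CStarMatrix ι κ A) (p : ο × ι) (q : ο × κ) :
    replicate ο a p q = if p.1 = q.1 then a p.2 q.2 else 0 := rfl

lemma replicate_mul (a : CStarMatrix ι κ A) (b : CStarMatrix κ μ A) :
    replicate ο (a * b) = replicate ο a * replicate ο b := by
  ext ⟨o, i⟩ ⟨o', j⟩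
  simp only [replicate_apply, CStarMatrix.mul_apply, Fintype.sum_prod_type]
  rw [Finset.sum_eq_single o]
  · by_cases h : o = o' <;> simp [h]
  · intro x _ hx
    simp [hx.symm]
  · simp

lemma continuous_replicate : Continuous (replicate ο : CStarMatrix ι κ A → _) := by
  refine continuous_pi fun p => continuous_pi fun q => ?_
  by_cases h : p.1 = q.1
  · simp only [replicate_apply, h, if_true]
    exact (continuous_apply q.2).comp (continuous_apply p.2)
  · simp only [replicate_apply, h, if_false]
    exact continuous_const

variable (A ι ο) in
/-- `replicate` as a unital `*`-homomorphism. -/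
def replicateHom [DecidableEq ι] :
    CStarMatrix ι ι A →⋆ₐ[ℂ] CStarMatrix (ο × ι) (ο × ι) A where
  toFun := replicate ο
  map_one' := by
    ext ⟨o, i⟩ ⟨o', j⟩
    simp only [replicate_apply, CStarMatrix.one_apply, Prod.mk.injEq]
    split_ifs <;> simp_all
  map_mul' := replicate_mul
  map_zero' := by
    ext p q
    simp [replicate_apply]
  map_add' a b := by
    ext p q
    simp only [replicate_apply, CStarMatrix.add_apply]
    split_ifs <;> simp
  commutes' r := by
    ext ⟨o, i⟩ ⟨o', j⟩
    simp only [replicate_apply, CStarMatrix.algebraMap_apply, Prod.mk.injEq]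
    split_ifs <;> simp_all
  map_star' a := by
    ext p q
    simp only [replicate_apply, CStarMatrix.star_apply]
    split_ifs <;> simp_all

lemma replicate_nonneg {a : CStarMatrix ι ι A} (ha : 0 ≤ a) : 0 ≤ replicate ο a := by
  classical
  exact map_nonneg (replicateHom A ι ο) ha

lemma cutDown_replicate [DecidableEq ι] {a : CStarMatrix ι ι A} (ha : 0 ≤ a) (ε : ℝ) :
    cutDown (replicate ο a) ε = replicate ο (cutDown a ε) :=
  (map_cutDown (replicateHom A ι ο) (.of_nonneg ha) ε).symm

end replicate

end Blocks

/-! ### The ordered monoid W(A). -/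

section CuntzSemigroup

variable {A : Type u} [CStarAlgebra A] [PartialOrder A] [StarOrderedRing A]
variable {ι κ : Type*} [Fintype ι] [Fintype κ]

/-- The square matrix obtained from `b` by pulling back rows and columns along `f`. -/
def CStarMatrix.pullback (b : CStarMatrix κ κ A) (f : ι → κ) : CStarMatrix ι ι A :=
  CStarMatrix.ofMatrix fun i j => b (f i) (f j)

@[simp]
lemma CStarMatrix.pullback_apply (b : CStarMatrix κ κ A) (f : ι → κ) (i j : ι) :
    b.pullback f i j = b (f i) (f j) := rfl

lemma CStarMatrix.pullback_nonneg {b : CStarMatrix κ κ A} (hb : 0 ≤ b) (f : ι → κ) :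
    0 ≤ b.pullback f := by
  classical
  let v : CStarMatrix κ ι A := CStarMatrix.ofMatrix fun k i => if k = f i then 1 else 0
  have hv : ∀ k i, v k i = if k = f i then 1 else 0 := fun _ _ => rfl
  have h := CStarMatrix.conjTranspose_mul_mul_nonneg hb v
  convert h using 1
  ext i j
  simp [CStarMatrix.mul_apply, hv, apply_ite star]

variable (A) in
/-- Positive matrices of arbitrary size. -/
def PosMatrix : Type u := Σ n : ℕ, {a : CStarMatrix (Fin n) (Fin n) A // 0 ≤ a}

instance : Preorder (PosMatrix A) where
  le x y := CuntzSub x.2.1 y.2.1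
  le_refl x := CuntzSub.refl _
  le_trans _ _ _ h h' := CuntzSub.trans h h'

variable (A) in
/-- The Cuntz semigroup `W(A)`. -/
def CuntzSemigroup : Type u := Antisymmetrization (PosMatrix A) (· ≤ ·)

namespace CuntzSemigroup

instance : PartialOrder (CuntzSemigroup A) :=
  inferInstanceAs (PartialOrder (Antisymmetrization (PosMatrix A) (· ≤ ·)))

/-- The class of a positive matrix in the Cuntz semigroup. -/
noncomputable def mk (a : CStarMatrix ι ι A) (ha : 0 ≤ a) : CuntzSemigroup A :=
  toAntisymmetrization (· ≤ ·) (⟨Fintype.card ι, ⟨a.pullback (Fintype.equivFin ι).symm,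
    CStarMatrix.pullback_nonneg ha _⟩⟩ : PosMatrix A)

lemma mk_le_mk_iff {a : CStarMatrix ι ι A} {b : CStarMatrix κ κ A} (ha : 0 ≤ a) (hb : 0 ≤ b) :
    mk a ha ≤ mk b hb ↔ CuntzSub a b := by
  have h1 : CuntzSub a (a.pullback (Fintype.equivFin ι).symm) :=
    .of_entries (Fintype.equivFin ι) fun i j => by simp
  have h1' : CuntzSub (a.pullback (Fintype.equivFin ι).symm) a :=
    .of_entries (Fintype.equivFin ι).symm fun i j => rfl
  have h2 : CuntzSub b (b.pullback (Fintype.equivFin κ).symm) :=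
    .of_entries (Fintype.equivFin κ) fun i j => by simp
  have h2' : CuntzSub (b.pullback (Fintype.equivFin κ).symm) b :=
    .of_entries (Fintype.equivFin κ).symm fun i j => rfl
  refine ⟨fun h => (h1.trans ?_).trans h2', fun h => ?_⟩
  · exact h
  · exact (h1'.trans h).trans h2

lemma mk_eq_mk {a : CStarMatrix ι ι A} {b : CStarMatrix κ κ A} (ha : 0 ≤ a) (hb : 0 ≤ b)
    (h : CuntzSub a b) (h' : CuntzSub b a) : mk a ha = mk b hb :=
  le_antisymm ((mk_le_mk_iff ha hb).mpr h) ((mk_le_mk_iff hb ha).mpr h')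

lemma mk_eq_mk_of_equiv {a : CStarMatrix ι ι A} {b : CStarMatrix κ κ A} (ha : 0 ≤ a) (hb : 0 ≤ b)
    (e : ι ≃ κ) (h : ∀ i j, a i j = b (e i) (e j)) : mk a ha = mk b hb :=
  mk_eq_mk ha hb (.of_entries e h) (.of_entries e.symm fun i j => by simp [h])

lemma toAntisymmetrization_eq_mk (x : PosMatrix A) :
    (toAntisymmetrization (· ≤ ·) x : CuntzSemigroup A) = mk x.2.1 x.2.2 := by
  refine Quotient.sound ⟨?_, ?_⟩
  · exact CuntzSub.of_entries (Fintype.equivFin (Fin x.1)) fun i j => by simp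
  · exact CuntzSub.of_entries (Fintype.equivFin (Fin x.1)).symm fun i j => rfl

lemma exists_eq_mk (x : CuntzSemigroup A) :
    ∃ (n : ℕ) (a : CStarMatrix (Fin n) (Fin n) A) (ha : 0 ≤ a), x = mk a ha := by
  induction x using Quotient.inductionOn with
  | h x => exact ⟨x.1, x.2.1, x.2.2, toAntisymmetrization_eq_mk x⟩

noncomputable instance : Add (CuntzSemigroup A) where
  add := Quotient.lift₂
    (fun a b : PosMatrix A => mk (blockSum a.2.1 b.2.1) (blockSum_nonneg a.2.2 b.2.2))
    fun _ _ _ _ h h' => mk_eq_mk _ _ (CuntzSub.blockSum h.1 h'.1) (CuntzSub.blockSum h.2 h'.2)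

lemma mk_add_mk {a : CStarMatrix ι ι A} {b : CStarMatrix κ κ A} (ha : 0 ≤ a) (hb : 0 ≤ b) :
    mk a ha + mk b hb = mk (blockSum a b) (blockSum_nonneg ha hb) :=
  (mk_eq_mk_of_equiv (blockSum_nonneg ha hb)
    (blockSum_nonneg (CStarMatrix.pullback_nonneg ha _) (CStarMatrix.pullback_nonneg hb _))
    ((Fintype.equivFin ι).sumCongr (Fintype.equivFin κ))
    (by rintro (i | i) (j | j) <;> simp)).symm

noncomputable instance : Zero (CuntzSemigroup A) where
  zero := mk (0 : CStarMatrix (Fin 0) (Fin 0) A) le_rfl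

lemma zero_def : (0 : CuntzSemigroup A) = mk (0 : CStarMatrix (Fin 0) (Fin 0) A) le_rfl := rfl

protected lemma add_comm (x y : CuntzSemigroup A) : x + y = y + x := by
  obtain ⟨n, a, ha, rfl⟩ := exists_eq_mk x
  obtain ⟨m, b, hb, rfl⟩ := exists_eq_mk y
  rw [mk_add_mk, mk_add_mk]
  exact mk_eq_mk_of_equiv _ _ (Equiv.sumComm _ _) (by rintro (i | i) (j | j) <;> simp)

protected lemma zero_add (x : CuntzSemigroup A) : 0 + x = x := by
  obtain ⟨n, a, ha, rfl⟩ := exists_eq_mk x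
  rw [zero_def, mk_add_mk]
  refine (mk_eq_mk_of_equiv _ _ (Equiv.emptySum (Fin 0) (Fin n)).symm fun i j => ?_).symm
  simp

noncomputable instance : AddCommMonoid (CuntzSemigroup A) where
  add_assoc x y z := by
    obtain ⟨n, a, ha, rfl⟩ := exists_eq_mk x
    obtain ⟨m, b, hb, rfl⟩ := exists_eq_mk y
    obtain ⟨k, c, hc, rfl⟩ := exists_eq_mk z
    simp only [mk_add_mk]
    exact mk_eq_mk_of_equiv _ _ (Equiv.sumAssoc _ _ _)
      (by rintro ((i | i) | i) ((j | j) | j) <;> simp)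
  zero_add := CuntzSemigroup.zero_add
  add_zero x := by rw [CuntzSemigroup.add_comm, CuntzSemigroup.zero_add]
  add_comm := CuntzSemigroup.add_comm
  nsmul := nsmulRec

instance : IsOrderedAddMonoid (CuntzSemigroup A) where
  add_le_add_left x y h z := by
    obtain ⟨n, a, ha, rfl⟩ := exists_eq_mk x
    obtain ⟨m, b, hb, rfl⟩ := exists_eq_mk y
    obtain ⟨k, c, hc, rfl⟩ := exists_eq_mk z
    rw [mk_add_mk, mk_add_mk, mk_le_mk_iff]
    exact CuntzSub.blockSum ((mk_le_mk_iff ha hb).mp h) (CuntzSub.refl c)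

protected lemma zero_le (x : CuntzSemigroup A) : 0 ≤ x := by
  obtain ⟨n, a, ha, rfl⟩ := exists_eq_mk x
  rw [zero_def, mk_le_mk_iff]
  exact .of_entries Fin.elim0 fun i => i.elim0

lemma mk_replicate {a : CStarMatrix ι ι A} (ha : 0 ≤ a) (k : ℕ) :
    mk (replicate (Fin k) a) (replicate_nonneg ha) = k • mk a ha := by
  induction k with
  | zero =>
    rw [zero_smul, zero_def]
    exact mk_eq_mk_of_equiv _ _ (Equiv.equivOfIsEmpty _ _) fun i => i.1.elim0
  | succ k ih =>
    rw [succ_nsmul, ← ih, mk_add_mk]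
    refine (mk_eq_mk_of_equiv _ _ ((((finSumFinEquiv (m := k) (n := 1)).symm.prodCongr
      (.refl ι)).trans (Equiv.sumProdDistrib _ _ _)).trans
      (Equiv.sumCongr (.refl _) (Equiv.uniqueProd ι (Fin 1)))).symm ?_).symm
    rintro (⟨i, x⟩ | x) (⟨j, y⟩ | y) <;>
      simp [replicate_apply, Fin.ext_iff, Fin.castAdd, Fin.natAdd]
    · omega
    · omega

variable (A) in
/-- The class of the unit of `A`. -/
noncomputable def unit : CuntzSemigroup A :=
  mk (1 : CStarMatrix (Fin 1) (Fin 1) A) zero_le_one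

lemma mk_one [DecidableEq ι] :
    mk (1 : CStarMatrix ι ι A) zero_le_one = Fintype.card ι • unit A := by
  rw [unit, ← mk_replicate]
  refine mk_eq_mk_of_equiv _ _ ((Fintype.equivFin ι).trans
    (Equiv.prodUnique (Fin (Fintype.card ι)) (Fin 1)).symm) fun i j => ?_
  simp [replicate_apply, CStarMatrix.one_apply]

lemma mk_le_card_nsmul_unit {a : CStarMatrix ι ι A} (ha : 0 ≤ a) :
    mk a ha ≤ Fintype.card ι • unit A := by
  classical
  rw [← mk_one, mk_le_mk_iff]
  obtain ⟨s, rfl⟩ := exists_eq_star_mul_self_of_nonneg ha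
  refine .of_eq (v := s) ?_
  have : star s * 1 * s = star s * s := by rw [mul_one]
  exact this

lemma exists_le_nsmul_unit (x : CuntzSemigroup A) : ∃ N : ℕ, x ≤ N • unit A := by
  obtain ⟨n, a, ha, rfl⟩ := exists_eq_mk x
  exact ⟨_, mk_le_card_nsmul_unit ha⟩

lemma mk_one_le_mk_cutDown_one [DecidableEq ι] {ε : ℝ} (hε : ε < 1) :
    mk (1 : CStarMatrix ι ι A) zero_le_one ≤ mk (cutDown (1 : CStarMatrix ι ι A) ε)
      (cutDown_nonneg _ _) := by
  rw [mk_le_mk_iff]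
  obtain ⟨v, hv⟩ := exists_star_mul_cutDown_one_mul_eq_one (B := CStarMatrix ι ι A) hε
  exact .of_eq (v := v) hv

end CuntzSemigroup

end CuntzSemigroup

/-! ### Dimension functions and states on W(A). -/

section DimensionFunctions

variable {A : Type u} [CStarAlgebra A] [PartialOrder A] [StarOrderedRing A]
variable {ι κ : Type*} [Fintype ι] [Fintype κ]

lemma matDirectSum_eq_blockSum {n m : ℕ} (a : CStarMatrix (Fin n) (Fin n) A)
    (b : CStarMatrix (Fin m) (Fin m) A) (i j : Fin (n + m)) :
    matDirectSum a b i j = blockSum a b (finSumFinEquiv.symm i) (finSumFinEquiv.symm j) := rfl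

lemma matDirectSum_nonneg {n m : ℕ} {a : CStarMatrix (Fin n) (Fin n) A}
    {b : CStarMatrix (Fin m) (Fin m) A} (ha : 0 ≤ a) (hb : 0 ≤ b) : 0 ≤ matDirectSum a b :=
  CStarMatrix.pullback_nonneg (blockSum_nonneg ha hb) finSumFinEquiv.symm

namespace CuntzSemigroup

lemma mk_add_mk_eq_mk_matDirectSum {n m : ℕ} {a : CStarMatrix (Fin n) (Fin n) A}
    {b : CStarMatrix (Fin m) (Fin m) A} (ha : 0 ≤ a) (hb : 0 ≤ b) :
    mk a ha + mk b hb = mk (matDirectSum a b) (matDirectSum_nonneg ha hb) := by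
  rw [mk_add_mk]
  exact (mk_eq_mk_of_equiv _ _ finSumFinEquiv.symm (matDirectSum_eq_blockSum a b)).symm

end CuntzSemigroup

open CuntzSemigroup

namespace LowerSemicontinuousDimensionFunction

/-- The function on the Cuntz semigroup induced by a dimension function. -/
def onCuntzSemigroup (d : LowerSemicontinuousDimensionFunction A) : CuntzSemigroup A → ℝ :=
  Quotient.lift (fun x : PosMatrix A => d.toFun x.1 x.2.1)
    fun x y h => le_antisymm (d.mono _ _ x.2.2 y.2.2 h.1) (d.mono _ _ y.2.2 x.2.2 h.2)

lemma onCuntzSemigroup_mk (d : LowerSemicontinuousDimensionFunction A) {n : ℕ}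
    {a : CStarMatrix (Fin n) (Fin n) A} (ha : 0 ≤ a) :
    d.onCuntzSemigroup (CuntzSemigroup.mk a ha) = d.toFun n a := by
  rw [← toAntisymmetrization_eq_mk ⟨n, a, ha⟩]
  rfl

lemma onCuntzSemigroup_add (d : LowerSemicontinuousDimensionFunction A) (x y : CuntzSemigroup A) :
    d.onCuntzSemigroup (x + y) = d.onCuntzSemigroup x + d.onCuntzSemigroup y := by
  obtain ⟨n, a, ha, rfl⟩ := exists_eq_mk x
  obtain ⟨m, b, hb, rfl⟩ := exists_eq_mk y
  rw [mk_add_mk_eq_mk_matDirectSum, onCuntzSemigroup_mk, onCuntzSemigroup_mk, onCuntzSemigroup_mk,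
    d.add a b ha hb]

lemma onCuntzSemigroup_mono (d : LowerSemicontinuousDimensionFunction A) :
    Monotone d.onCuntzSemigroup := by
  intro x y h
  obtain ⟨n, a, ha, rfl⟩ := exists_eq_mk x
  obtain ⟨m, b, hb, rfl⟩ := exists_eq_mk y
  rw [onCuntzSemigroup_mk, onCuntzSemigroup_mk]
  exact d.mono a b ha hb ((mk_le_mk_iff ha hb).mp h)

/-- The additive map on the Cuntz semigroup induced by a dimension function. -/
def toAddMonoidHom (d : LowerSemicontinuousDimensionFunction A) : CuntzSemigroup A →+ ℝ where
  toFun := d.onCuntzSemigroup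
  map_zero' := by
    have h := d.onCuntzSemigroup_add 0 0
    rw [add_zero] at h
    linarith
  map_add' := d.onCuntzSemigroup_add

lemma toAddMonoidHom_mk (d : LowerSemicontinuousDimensionFunction A) {n : ℕ}
    {a : CStarMatrix (Fin n) (Fin n) A} (ha : 0 ≤ a) :
    d.toAddMonoidHom (CuntzSemigroup.mk a ha) = d.toFun n a := d.onCuntzSemigroup_mk ha

lemma toAddMonoidHom_unit (d : LowerSemicontinuousDimensionFunction A) :
    d.toAddMonoidHom (unit A) = 1 := (d.toAddMonoidHom_mk _).trans d.one

lemma toAddMonoidHom_mono (d : LowerSemicontinuousDimensionFunction A) :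
    Monotone d.toAddMonoidHom := d.onCuntzSemigroup_mono

end LowerSemicontinuousDimensionFunction

/-- The lower semicontinuous regularization of a function on the Cuntz semigroup. -/
noncomputable def lscRegularization [DecidableEq ι] (f : CuntzSemigroup A → ℝ)
    (a : CStarMatrix ι ι A) : ℝ :=
  ⨆ ε : Set.Ioi (0 : ℝ), f (mk (cutDown a ε) (cutDown_nonneg a ε))

section Regularization

variable {f : CuntzSemigroup A →+ ℝ} [DecidableEq ι] [DecidableEq κ]

lemma apply_mk_cutDown_le (hf : Monotone f) {a : CStarMatrix ι ι A} (ha : 0 ≤ a) {ε : ℝ}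
    (hε : 0 ≤ ε) : f (mk (cutDown a ε) (cutDown_nonneg a ε)) ≤ f (mk a ha) :=
  hf ((mk_le_mk_iff _ _).mpr (CuntzSub.cutDown_self ha hε))

lemma bddAbove_apply_mk_cutDown (hf : Monotone f) {a : CStarMatrix ι ι A} (ha : 0 ≤ a) :
    BddAbove (Set.range fun ε : Set.Ioi (0 : ℝ) => f (mk (cutDown a ε) (cutDown_nonneg a ε))) :=
  ⟨f (mk a ha), by
    rintro _ ⟨ε, rfl⟩
    exact apply_mk_cutDown_le hf ha (le_of_lt ε.2)⟩

lemma apply_mk_cutDown_le_lscRegularization (hf : Monotone f) {a : CStarMatrix ι ι A} (ha : 0 ≤ a)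
    {ε : ℝ} (hε : 0 < ε) :
    f (mk (cutDown a ε) (cutDown_nonneg a ε)) ≤ lscRegularization f a :=
  le_ciSup (bddAbove_apply_mk_cutDown hf ha) ⟨ε, hε⟩

instance : Nonempty (Set.Ioi (0 : ℝ)) := ⟨⟨1, Set.mem_Ioi.mpr one_pos⟩⟩

lemma lscRegularization_le (hf : Monotone f) {a : CStarMatrix ι ι A} (ha : 0 ≤ a) :
    lscRegularization f a ≤ f (mk a ha) :=
  ciSup_le fun ε => apply_mk_cutDown_le hf ha (le_of_lt ε.2)

lemma lscRegularization_mono (hf : Monotone f) {a : CStarMatrix ι ι A} {b : CStarMatrix κ κ A}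
    (ha : 0 ≤ a) (hb : 0 ≤ b) (hab : CuntzSub a b) :
    lscRegularization f a ≤ lscRegularization f b := by
  refine ciSup_le fun ε => ?_
  obtain ⟨δ, hδ, h⟩ := hab.exists_cutDown ha hb ε.2
  exact (hf ((mk_le_mk_iff _ _).mpr h)).trans (apply_mk_cutDown_le_lscRegularization hf hb hδ)

lemma apply_mk_cutDown_anti (hf : Monotone f) {a : CStarMatrix ι ι A} (ha : 0 ≤ a) {ε δ : ℝ}
    (hδ : 0 ≤ δ) (hδε : δ ≤ ε) : f (mk (cutDown a ε) (cutDown_nonneg a ε)) ≤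
      f (mk (cutDown a δ) (cutDown_nonneg a δ)) := by
  refine hf ((mk_le_mk_iff _ _).mpr (CuntzSub.cutDown_of_norm_sub_le ha (cutDown_nonneg _ _) ?_))
  rw [norm_sub_rev]
  exact (norm_cutDown_sub_le ha hδ).trans hδε

/-- Cut-downs respect block sums, and their values grow as ε decreases, so two cutoffs can be
replaced by their minimum. -/
lemma lscRegularization_blockSum (hf : Monotone f) {a : CStarMatrix ι ι A} {b : CStarMatrix κ κ A}
    (ha : 0 ≤ a) (hb : 0 ≤ b) :
    lscRegularization f (blockSum a b) = lscRegularization f a + lscRegularization f b := by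
  have key : ∀ ε, f (mk (cutDown (blockSum a b) ε) (cutDown_nonneg _ ε)) =
      f (mk (cutDown a ε) (cutDown_nonneg a ε)) + f (mk (cutDown b ε) (cutDown_nonneg b ε)) := by
    intro ε
    rw [← map_add, mk_add_mk]
    simp only [cutDown_blockSum ha hb]
  refine le_antisymm (ciSup_le fun ε => ?_) (ciSup_add_ciSup_le fun ε δ => ?_)
  · rw [key]
    exact add_le_add (apply_mk_cutDown_le_lscRegularization hf ha ε.2)
      (apply_mk_cutDown_le_lscRegularization hf hb ε.2)
  · have hmin : 0 < min (ε : ℝ) δ := lt_min ε.2 δ.2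
    refine le_trans ?_ (apply_mk_cutDown_le_lscRegularization hf (blockSum_nonneg ha hb) hmin)
    rw [key]
    exact add_le_add (apply_mk_cutDown_anti hf ha hmin.le (min_le_left _ _))
      (apply_mk_cutDown_anti hf hb hmin.le (min_le_right _ _))

/-- If ‖a - b‖ < ε/2, then (a - ε)₊ ≾ (b - ε/2)₊, so a value nearly attained at a persists nearby.
-/
lemma lowerSemicontinuousOn_lscRegularization (hf : Monotone f) :
    LowerSemicontinuousOn (lscRegularization f : CStarMatrix ι ι A → ℝ) {a | 0 ≤ a} := by
  intro a ha y hy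
  obtain ⟨ε, hε⟩ := exists_lt_of_lt_ciSup hy
  have hε2 : 0 < (ε : ℝ) / 2 := half_pos ε.2
  filter_upwards [self_mem_nhdsWithin, mem_nhdsWithin_of_mem_nhds (Metric.ball_mem_nhds a hε2)]
    with b hb hab
  refine hε.trans_le (le_trans (hf ((mk_le_mk_iff _ _).mpr ?_))
    (apply_mk_cutDown_le_lscRegularization hf hb hε2))
  refine CuntzSub.cutDown_of_norm_sub_le ha (cutDown_nonneg _ _) ?_
  have h1 := norm_cutDown_sub_le hb hε2.le
  rw [mem_ball_iff_norm'] at hab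
  have h2 := norm_sub_le_norm_sub_add_norm_sub a b (cutDown b (ε / 2))
  rw [norm_sub_rev b] at h2
  linarith

end Regularization

/-- The lower semicontinuous dimension function obtained from a normalized state on the Cuntz
semigroup. -/
noncomputable def dimensionFunctionOfState (f : CuntzSemigroup A →+ ℝ) (hf : Monotone f)
    (hu : f (unit A) = 1) : LowerSemicontinuousDimensionFunction A where
  toFun n a := lscRegularization f a
  nonneg a ha := by
    refine le_trans ?_ (apply_mk_cutDown_le_lscRegularization hf ha one_pos)
    rw [← map_zero f]
    exact hf (CuntzSemigroup.zero_le _)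
  mono a b ha hb hab := lscRegularization_mono hf ha hb hab
  add {n m} a b ha hb := by
    rw [← lscRegularization_blockSum hf ha hb]
    refine le_antisymm (lscRegularization_mono hf (matDirectSum_nonneg ha hb)
      (blockSum_nonneg ha hb) (.of_entries finSumFinEquiv.symm (matDirectSum_eq_blockSum a b)))
      (lscRegularization_mono hf (blockSum_nonneg ha hb) (matDirectSum_nonneg ha hb)
        (.of_entries finSumFinEquiv fun i j => ?_))
    simp [matDirectSum_eq_blockSum]
  one := by
    have h1 : (0 : CStarMatrix (Fin 1) (Fin 1) A) ≤ 1 := zero_le_one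
    refine le_antisymm ((lscRegularization_le hf h1).trans hu.le) ?_
    -- A cutoff below 1 leaves a positive multiple of the unit, so 1/2 already gives the full value.
    refine le_trans ?_ (apply_mk_cutDown_le_lscRegularization hf h1 one_half_pos)
    rw [← hu]
    exact hf (mk_one_le_mk_cutDown_one (by rw [hu]; norm_num))
  lowerSemicontinuous n := lowerSemicontinuousOn_lscRegularization hf

end DimensionFunctions

/-! ### Stable finiteness of quotients. -/

section Quotient

/-- The `*`-ring structure on the quotient by a two-sided ideal that is closed under `star`. -/
@[reducible]
def Ideal.quotientStarRing {A : Type*} [Ring A] [StarRing A] (I : Ideal A) [I.IsTwoSided]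
    (hI : ∀ x ∈ I, star x ∈ I) : StarRing (A ⧸ I) where
  star := _root_.Quotient.lift (fun x => Ideal.Quotient.mk I (star x)) fun x y h => by
    rw [Ideal.Quotient.eq, ← star_sub]
    exact hI _ ((Submodule.quotientRel_def I).mp h)
  star_involutive x := by
    obtain ⟨x, rfl⟩ := Ideal.Quotient.mk_surjective x
    exact congrArg (Ideal.Quotient.mk I) (star_star x)
  star_mul x y := by
    obtain ⟨x, rfl⟩ := Ideal.Quotient.mk_surjective x
    obtain ⟨y, rfl⟩ := Ideal.Quotient.mk_surjective y
    exact congrArg (Ideal.Quotient.mk I) (star_mul x y)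
  star_add x y := by
    obtain ⟨x, rfl⟩ := Ideal.Quotient.mk_surjective x
    obtain ⟨y, rfl⟩ := Ideal.Quotient.mk_surjective y
    exact congrArg (Ideal.Quotient.mk I) (star_add x y)

/-- If all quotients of `A` are stably finite and `w` is an `N × (N + 1)` matrix that is an
isometry modulo a closed self-adjoint ideal, then the ideal is everything. -/
lemma AllQuotientsStablyFinite.one_mem {A : Type u} [CStarAlgebra A]
    (hA : AllQuotientsStablyFinite A) (I : Ideal A) [I.IsTwoSided] (hI : ∀ x ∈ I, star x ∈ I)
    (hIc : IsClosed (I : Set A)) {N : ℕ} (w : Matrix (Fin N) (Fin (N + 1)) A)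
    (hw : ∀ i j, (w.conjTranspose * w) i j - (1 : Matrix (Fin (N + 1)) (Fin (N + 1)) A) i j ∈ I) :
    (1 : A) ∈ I := by
  let := I.quotientStarRing hI
  let π : A →⋆ₐ[ℂ] A ⧸ I :=
    { Ideal.Quotient.mkₐ ℂ I with
      map_star' := fun x => rfl }
  have hπ : ∀ x, π x = 0 ↔ x ∈ I := fun x => Ideal.Quotient.eq_zero_iff_mem
  have hsf : StablyFinite (A ⧸ I) := by
    refine hA (A ⧸ I) π Ideal.Quotient.mk_surjective ?_
    convert hIc using 1
    ext x
    exact hπ x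
  -- Padding w with a zero last row gives a square isometry. It is unitary by stable finiteness, and
  -- the last diagonal entry of W W* then reads 0 = 1.
  let W : Matrix (Fin (N + 1)) (Fin (N + 1)) (A ⧸ I) :=
    Matrix.of fun i j => Fin.lastCases (motive := fun _ => A ⧸ I) 0 (fun k => π (w k j)) i
  have hW0 : ∀ j, W (Fin.last N) j = 0 := fun j => by simp [W]
  have hWs : ∀ k j, W (Fin.castSucc k) j = π (w k j) := fun k j => by simp [W]
  have hWW : star W * W = 1 := by
    ext i j
    have h1 : (star W * W) i j = π ((w.conjTranspose * w) i j) := by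
      rw [Matrix.star_eq_conjTranspose, Matrix.mul_apply, Fin.sum_univ_castSucc, Matrix.mul_apply,
        map_sum]
      simp [Matrix.conjTranspose_apply, hW0, hWs, map_star]
    have h2 : (1 : Matrix (Fin (N + 1)) (Fin (N + 1)) (A ⧸ I)) i j =
        π ((1 : Matrix (Fin (N + 1)) (Fin (N + 1)) A) i j) := by
      simp only [Matrix.one_apply]
      split_ifs <;> simp
    rw [h1, h2, ← sub_eq_zero, ← map_sub, hπ]
    exact hw i j
  have h := congrFun (congrFun (hsf (N + 1) W hWW) (Fin.last N)) (Fin.last N)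
  rw [Matrix.mul_apply, Matrix.one_apply_eq,
    Finset.sum_eq_zero fun j _ => by rw [hW0, zero_mul]] at h
  rw [← hπ, map_one, ← h]

end Quotient

/-! ### Full positive matrices. -/

section Full

variable {A : Type u} [CStarAlgebra A] [PartialOrder A] [StarOrderedRing A]

/-- The (algebraic) two-sided ideal generated by the entries of a matrix. -/
def entryIdeal {m : ℕ} (b : CStarMatrix (Fin m) (Fin m) A) : Ideal A :=
  Ideal.span {x | ∃ i j y, x = b i j * y}

section entryIdeal

variable {m : ℕ} (b : CStarMatrix (Fin m) (Fin m) A)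

lemma mul_entry_mul_mem_entryIdeal (x y : A) (i j : Fin m) : x * b i j * y ∈ entryIdeal b := by
  rw [mul_assoc]
  exact Ideal.mul_mem_left _ _ (Ideal.subset_span ⟨i, j, y, rfl⟩)

instance : (entryIdeal b).IsTwoSided where
  mul_mem_of_left {x} z hx := by
    induction hx using Submodule.span_induction with
    | mem x hx =>
      obtain ⟨i, j, y, rfl⟩ := hx
      rw [mul_assoc]
      exact Ideal.subset_span ⟨i, j, _, rfl⟩
    | zero => simp
    | add x y _ _ hx hy => rw [add_mul]; exact add_mem hx hy
    | smul a x _ hx => rw [smul_eq_mul, mul_assoc]; exact Ideal.mul_mem_left _ _ hx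

instance : (entryIdeal b).closure.IsTwoSided where
  mul_mem_of_left {x} z hx := by
    refine map_mem_closure (f := fun x => x * z) (by fun_prop) hx fun y hy => ?_
    exact Ideal.mul_mem_right _ _ hy

lemma star_mem_closure_entryIdeal {b : CStarMatrix (Fin m) (Fin m) A} (hb : IsSelfAdjoint b)
    {x : A} (hx : x ∈ (entryIdeal b).closure) : star x ∈ (entryIdeal b).closure := by
  refine map_mem_closure continuous_star hx fun y hy => ?_
  induction hy using Submodule.span_induction with
  | mem x hx =>
    obtain ⟨i, j, y, rfl⟩ := hx
    rw [star_mul, CStarMatrix.star_apply_of_isSelfAdjoint hb]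
    simpa using mul_entry_mul_mem_entryIdeal b (star y) 1 j i
  | zero => simp
  | add x y _ _ hx hy => rw [star_add]; exact add_mem hx hy
  | smul a x _ hx => rw [smul_eq_mul, star_mul]; exact Ideal.mul_mem_right _ _ hx

end entryIdeal

variable (A) in
/-- The `*`-homomorphism from `A` to the `1 × 1` matrices over `A`. -/
def scalarMatrixHom : A →⋆ₐ[ℂ] CStarMatrix (Fin 1) (Fin 1) A where
  toFun a := CStarMatrix.ofMatrix fun _ _ => a
  map_one' := by ext i j; simp [CStarMatrix.one_apply, Subsingleton.elim i j]; rfl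
  map_mul' _ _ := by ext; simp [CStarMatrix.mul_apply]; rfl
  map_zero' := by ext; simp; rfl
  map_add' _ _ := by ext; simp; rfl
  commutes' r := by ext i j; simp [CStarMatrix.algebraMap_apply, Subsingleton.elim i j]; rfl
  map_star' _ := by ext; simp [CStarMatrix.star_apply]; rfl

@[simp]
lemma scalarMatrixHom_apply (a : A) (i j : Fin 1) : scalarMatrixHom A a i j = a := rfl

open CuntzSemigroup

namespace CuntzSemigroup

lemma mk_add_le {ι : Type*} [Fintype ι] {a b : CStarMatrix ι ι A} (ha : 0 ≤ a) (hb : 0 ≤ b) :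
    mk (a + b) (add_nonneg ha hb) ≤ mk a ha + mk b hb := by
  classical
  rw [mk_add_mk, mk_le_mk_iff]
  let v : CStarMatrix (ι ⊕ ι) ι A := CStarMatrix.ofMatrix (Sum.elim
    (fun i j => if i = j then 1 else 0) (fun i j => if i = j then 1 else 0))
  have hvl : ∀ i j, v (.inl i) j = if i = j then 1 else 0 := fun _ _ => rfl
  have hvr : ∀ i j, v (.inr i) j = if i = j then 1 else 0 := fun _ _ => rfl
  refine .of_eq (v := v) ?_
  ext i j
  simp [CStarMatrix.mul_apply, hvl, hvr, apply_ite star]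

/-- An element of the (algebraic) ideal generated by the entries of `b` is dominated by a positive
element whose class is at most a multiple of the class of `b`. -/
lemma exists_add_star_le_of_mem_entryIdeal {m : ℕ} {b : CStarMatrix (Fin m) (Fin m) A}
    (hb : 0 ≤ b) {z : A} (hz : z ∈ entryIdeal b) (x : A) :
    ∃ (h : CStarMatrix (Fin 1) (Fin 1) A) (h0 : 0 ≤ h),
      scalarMatrixHom A (x * z + star (x * z)) ≤ h ∧
        ∃ N : ℕ, mk h h0 ≤ N • mk b hb := by
  -- The factor x is general so that left multiplication in the ideal can be absorbed into it.
  induction hz using Submodule.span_induction generalizing x with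
  | mem z hz =>
    obtain ⟨i, j, y, rfl⟩ := hz
    let p : CStarMatrix (Fin m) (Fin 1) A :=
      CStarMatrix.ofMatrix fun k _ => if k = i then star x else 0
    let q : CStarMatrix (Fin m) (Fin 1) A :=
      CStarMatrix.ofMatrix fun k _ => if k = j then y else 0
    have hp : ∀ k l, p k l = if k = i then star x else 0 := fun _ _ => rfl
    have hq : ∀ k l, q k l = if k = j then y else 0 := fun _ _ => rfl
    have hpp := CStarMatrix.conjTranspose_mul_mul_nonneg hb p
    have hqq := CStarMatrix.conjTranspose_mul_mul_nonneg hb q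
    refine ⟨p.conjTranspose * b * p + q.conjTranspose * b * q, add_nonneg hpp hqq, ?_, 2, ?_⟩
    · rw [← sub_nonneg]
      -- Polarization: (p - q)* b (p - q) ≥ 0 bounds the cross terms, which are x b_ij y and its
      -- adjoint, by p* b p + q* b q.
      have h := CStarMatrix.conjTranspose_mul_mul_nonneg hb (p - q)
      convert h using 1
      have hba : ∀ k l, star (b k l) = b l k := fun k l =>
        CStarMatrix.star_apply_of_isSelfAdjoint (.of_nonneg hb)
      ext k l
      simp [CStarMatrix.mul_apply, hp, hq, apply_ite star, sub_mul, mul_sub,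
        hba, Finset.sum_sub_distrib, mul_assoc]
      abel
    · refine (mk_add_le hpp hqq).trans ?_
      rw [two_nsmul]
      exact add_le_add ((mk_le_mk_iff _ _).mpr (CuntzSub.conj p b))
        ((mk_le_mk_iff _ _).mpr (CuntzSub.conj q b))
  | zero =>
    refine ⟨0, le_rfl, by simp, 0, ?_⟩
    rw [zero_smul, zero_def, mk_le_mk_iff]
    exact .of_eq (v := 0) (by simp)
  | add z w _ _ hz hw =>
    obtain ⟨h, h0, hle, N, hN⟩ := hz x
    obtain ⟨h', h0', hle', N', hN'⟩ := hw x
    refine ⟨h + h', add_nonneg h0 h0', ?_, N + N', ?_⟩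
    · refine le_trans (le_of_eq ?_) (add_le_add hle hle')
      rw [← map_add]
      congr 1
      rw [mul_add, star_add]
      abel
    · rw [add_smul]
      exact (mk_add_le h0 h0').trans (add_le_add hN hN')
  | smul a z _ hz =>
    obtain ⟨h, h0, hle, hN⟩ := hz (x * a)
    exact ⟨h, h0, by rwa [smul_eq_mul, ← mul_assoc], hN⟩

/-- A positive matrix whose entries generate `A` as a closed ideal is full in the Cuntz
semigroup. -/
lemma exists_unit_le_nsmul_of_one_mem_closure {m : ℕ} {b : CStarMatrix (Fin m) (Fin m) A}
    (hb : 0 ≤ b) (h1 : (1 : A) ∈ (entryIdeal b).closure) :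
    ∃ N : ℕ, unit A ≤ N • mk b hb := by
  obtain ⟨z, hz, hdist⟩ := Metric.mem_closure_iff.mp h1 (1 / 2) one_half_pos
  rw [dist_eq_norm] at hdist
  obtain ⟨h, h0, hle, N, hN⟩ := exists_add_star_le_of_mem_entryIdeal hb hz 1
  refine ⟨N, le_trans ?_ hN⟩
  rw [unit, mk_le_mk_iff]
  refine CuntzSub.of_le zero_le_one (le_trans ?_ hle)
  have hsa : IsSelfAdjoint ((1 - z) + star (1 - z)) := IsSelfAdjoint.add_star_self _
  have hn : ‖(1 - z) + star (1 - z)‖ ≤ 1 := by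
    refine (norm_add_le _ _).trans ?_
    rw [norm_star]
    linarith
  have hle1 : (1 - z) + star (1 - z) ≤ 1 := by
    have h2 := hsa.le_algebraMap_norm_self.trans (algebraMap_mono A hn)
    rwa [map_one] at h2
  have hle2 : (1 : A) ≤ 1 * z + star (1 * z) := by
    rw [← sub_nonneg] at hle1 ⊢
    convert hle1 using 1
    rw [one_mul, star_sub, star_one]
    abel
  have h3 := map_nonneg (scalarMatrixHom A) (sub_nonneg.mpr hle2)
  rw [map_sub, map_one, sub_nonneg] at h3
  exact h3

/-- If `b` together with `N` copies of the unit dominates `N + 1` copies of the unit, then `b` is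
full, provided that all quotients are stably finite. -/
lemma exists_unit_le_nsmul_of_succ_nsmul_le (hA : AllQuotientsStablyFinite A) {m : ℕ}
    {b : CStarMatrix (Fin m) (Fin m) A} (hb : 0 ≤ b) {N K : ℕ}
    (h : (N + 1) • unit A ≤ K • mk b hb + N • unit A) :
    ∃ N' : ℕ, unit A ≤ N' • mk b hb := by
  have h1 : mk (1 : CStarMatrix (Fin (N + 1)) (Fin (N + 1)) A) zero_le_one ≤
      mk (blockSum (replicate (Fin K) b) (1 : CStarMatrix (Fin N) (Fin N) A))
        (blockSum_nonneg (replicate_nonneg hb) zero_le_one) := by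
    rw [← mk_add_mk (replicate_nonneg hb) (zero_le_one (α := CStarMatrix (Fin N) (Fin N) A)),
      mk_replicate, mk_one, mk_one]
    simpa using h
  rw [mk_le_mk_iff] at h1
  obtain ⟨v, hv⟩ := h1 1 one_pos
  set B := blockSum (replicate (Fin K) b) (1 : CStarMatrix (Fin N) (Fin N) A) with hB
  have hB0 : 0 ≤ B := blockSum_nonneg (replicate_nonneg hb) zero_le_one
  obtain ⟨y, hy⟩ := exists_star_mul_mul_eq_one_of_norm_sub_one_lt
    (CStarMatrix.conjTranspose_mul_mul_nonneg hB0 v) hv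
  -- Correcting by y makes V* B V = 1 exact. The rows of V belonging to the unit block form the
  -- isometry modulo the ideal, since the other rows contribute only entries of b.
  set V := v * y with hV
  have hVB : V.conjTranspose * B * V = 1 := by
    rw [← hy, hV, CStarMatrix.conjTranspose_rect_mul]
    change _ = y.conjTranspose * (v.conjTranspose * B * v) * y
    simp only [CStarMatrix.rect_mul_assoc]
  refine exists_unit_le_nsmul_of_one_mem_closure hb
    (hA.one_mem (entryIdeal b).closure
      (fun x hx => star_mem_closure_entryIdeal (.of_nonneg hb) hx) isClosed_closure
      (Matrix.of fun i j => V (.inr i) j) fun i j => ?_)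
  refine subset_closure ?_
  have hij : (1 : Matrix (Fin (N + 1)) (Fin (N + 1)) A) i j =
      (∑ p : Fin K × Fin m, ∑ q : Fin K × Fin m,
        star (V (.inl p) i) * replicate (Fin K) b p q * V (.inl q) j) +
      ((Matrix.of fun i j => V (.inr i) j).conjTranspose *
        (Matrix.of fun i j => V (.inr i) j : Matrix (Fin N) (Fin (N + 1)) A)) i j := by
    have h2 : (1 : Matrix (Fin (N + 1)) (Fin (N + 1)) A) i j =
        (V.conjTranspose * B * V) i j := by rw [hVB]; rfl
    rw [h2, CStarMatrix.mul_apply, Fintype.sum_sum_type]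
    congr 1
    · rw [Finset.sum_comm]
      refine Finset.sum_congr rfl fun q _ => ?_
      rw [CStarMatrix.mul_apply, Fintype.sum_sum_type, ← Finset.sum_mul]
      simp [hB]
    · rw [Matrix.mul_apply]
      refine Finset.sum_congr rfl fun q _ => ?_
      rw [CStarMatrix.mul_apply, Fintype.sum_sum_type]
      simp [hB, CStarMatrix.one_apply]
  rw [hij, sub_add_cancel_right]
  refine neg_mem (sum_mem fun p _ => sum_mem fun q _ => ?_)
  rw [replicate_apply]
  split_ifs
  · exact mul_entry_mul_mem_entryIdeal b _ _ _ _
  · simp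

/-- If all quotients of `A` are stably finite, then a positive matrix on which no dimension
function vanishes is full. -/
lemma exists_unit_le_nsmul (hA : AllQuotientsStablyFinite A) {m : ℕ}
    {b : CStarMatrix (Fin m) (Fin m) A} (hb : 0 ≤ b)
    (hpos : ∀ d : LowerSemicontinuousDimensionFunction A, 0 < d.toFun m b) :
    ∃ N : ℕ, unit A ≤ N • mk b hb := by
  rcases exists_state_or (unit A) CuntzSemigroup.zero_le exists_le_nsmul_unit 0 (mk b hb) 0
    le_rfl with ⟨f, hf, hu, hfb⟩ | ⟨n, s, hn, hs, z, hz⟩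
  · have h1 := hpos (dimensionFunctionOfState f hf hu)
    have h2 : (dimensionFunctionOfState f hf hu).toFun m b ≤ f (mk b hb) :=
      lscRegularization_le hf hb
    rw [map_zero] at hfb
    linarith
  · have hs' : 0 < s := by
      rw [zero_mul] at hs
      exact_mod_cast hs
    rw [smul_zero, zero_add] at hz
    obtain ⟨N, hN⟩ := exists_le_nsmul_unit z
    -- As z ≤ N[1], taking N + 1 copies leaves a surplus of one unit.
    have h1 := exists_nsmul_le_of_add_le_add CuntzSemigroup.zero_le hz (N + 1)
    refine exists_unit_le_nsmul_of_succ_nsmul_le hA hb (N := N) (K := (N + 1) * n) ?_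
    calc (N + 1) • unit A ≤ ((N + 1) * s) • unit A :=
          nsmul_le_nsmul_left (CuntzSemigroup.zero_le _) (Nat.le_mul_of_pos_right _ hs')
      _ = (N + 1) • s • unit A := mul_smul _ _ _
      _ ≤ (N + 1) • n • mk b hb + z := h1
      _ ≤ ((N + 1) * n) • mk b hb + N • unit A := by
          rw [mul_smul]
          gcongr

end CuntzSemigroup

end Full

/-! ### Passing inequalities in W(A) to approximating algebras. -/

section Transfer

variable {A : Type u} [CStarAlgebra A] [PartialOrder A] [StarOrderedRing A]
variable {C : Type u} [CStarAlgebra C] [PartialOrder C] [StarOrderedRing C]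
variable {ι κ μ ν : Type*} [Fintype ι] [Fintype κ] [Fintype μ] [Fintype ν]

open CuntzSemigroup

section Map

variable (φ : C →⋆ₐ[ℂ] A)

lemma CStarMatrix.map_rect_mul (M : CStarMatrix ι κ C) (N : CStarMatrix κ μ C) :
    (M * N).map φ = M.map φ * N.map φ := by
  ext i j
  simp [CStarMatrix.mul_apply]

lemma CStarMatrix.map_conjTranspose (M : CStarMatrix ι κ C) :
    M.conjTranspose.map φ = (M.map φ).conjTranspose := by
  ext i j
  simp [map_star]

lemma map_blockSum (M : CStarMatrix ι μ C) (N : CStarMatrix κ ν C) :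
    (blockSum M N).map φ = blockSum (M.map φ) (N.map φ) := by
  ext (i | i) (j | j) <;> simp

lemma map_replicate {ο : Type*} [DecidableEq ο] (M : CStarMatrix ι κ C) :
    (replicate ο M).map φ = replicate ο (M.map φ) := by
  ext i j
  simp only [replicate_apply, CStarMatrix.map_apply]
  split_ifs <;> simp

variable [DecidableEq ι]

lemma CStarMatrix.map_one_apply : (1 : CStarMatrix ι ι C).map φ = 1 := by
  ext i j
  simp only [CStarMatrix.one_apply, CStarMatrix.map_apply]
  split_ifs <;> simp

variable (ι) in
/-- The `*`-homomorphism of matrix algebras obtained by applying `φ` to all entries. -/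
def matrixHom : CStarMatrix ι ι C →⋆ₐ[ℂ] CStarMatrix ι ι A where
  toFun M := M.map φ
  map_one' := CStarMatrix.map_one_apply φ
  map_mul' := CStarMatrix.map_rect_mul φ
  map_zero' := by ext i j; simp
  map_add' M N := by ext i j; simp
  commutes' r := by
    ext i j
    simp only [CStarMatrix.algebraMap_apply, CStarMatrix.map_apply]
    split_ifs
    · exact AlgHomClass.commutes φ r
    · simp
  map_star' := CStarMatrix.map_conjTranspose φ

lemma matrixHom_apply (M : CStarMatrix ι ι C) : matrixHom ι φ M = M.map φ := rfl

variable {φ}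

lemma norm_matrixHom (hφ : Function.Injective φ) (M : CStarMatrix ι ι C) :
    ‖matrixHom ι φ M‖ = ‖M‖ :=
  NonUnitalStarAlgHom.norm_map (matrixHom ι φ) (CStarMatrix.map_injective hφ) M

lemma CuntzSub.map [DecidableEq κ] (hφ : Function.Injective φ) {a : CStarMatrix ι ι C}
    {b : CStarMatrix κ κ C} (h : CuntzSub a b) : CuntzSub (matrixHom ι φ a) (matrixHom κ φ b) := by
  intro ε hε
  obtain ⟨v, hv⟩ := h ε hε
  refine ⟨v.map φ, ?_⟩
  rw [← norm_matrixHom hφ, map_sub] at hv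
  simpa only [matrixHom_apply, CStarMatrix.map_rect_mul, CStarMatrix.map_conjTranspose] using hv

end Map

/-- A matrix over `A` can be approximated by matrices over any algebra that approximates its
entries well enough. -/
lemma exists_finset_forall_exists_norm_map_sub_lt (M : CStarMatrix ι κ A) {δ : ℝ} (hδ : 0 < δ) :
    ∃ (F : Finset A) (η : ℝ), 0 < η ∧ ∀ (C : Type u) [CStarAlgebra C] (φ : C →⋆ₐ[ℂ] A),
      (∀ a ∈ F, Metric.infDist a (Set.range φ) < η) →
        ∃ M' : CStarMatrix ι κ C, ‖M'.map φ - M‖ < δ := by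
  classical
  have hcont : Continuous fun f : ι → κ → A =>
      (CStarMatrix.ofMatrix (f : Matrix ι κ A) : CStarMatrix ι κ A) :=
    (CStarMatrix.ofMatrixL (m := ι) (n := κ) (A := A)).continuous
  obtain ⟨η, hη, hball⟩ := Metric.continuousAt_iff.mp
    (hcont.continuousAt (x := fun i j => M i j)) δ hδ
  refine ⟨Finset.univ.image fun p : ι × κ => M p.1 p.2, η, hη, fun C _ φ h => ?_⟩
  have h1 : ∀ i j, ∃ c : C, dist (φ c) (M i j) < η := by
    intro i j
    have h2 := h (M i j) (Finset.mem_image.mpr ⟨(i, j), Finset.mem_univ _, rfl⟩)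
    obtain ⟨_, ⟨c, rfl⟩, hc⟩ := (Metric.infDist_lt_iff (Set.range_nonempty φ)).mp h2
    exact ⟨c, by rwa [dist_comm]⟩
  choose c hc using h1
  refine ⟨CStarMatrix.ofMatrix c, ?_⟩
  have h2 := @hball (fun i j => φ (c i j))
    ((dist_pi_lt_iff hη).mpr fun i => (dist_pi_lt_iff hη).mpr fun j => hc i j)
  rw [dist_eq_norm] at h2
  exact h2

/-- An inequality `p [x] + s [1] ≤ q [b]` in the Cuntz semigroup of `A` holds approximately in the
Cuntz semigroup of every algebra that approximates `A` well enough. -/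
lemma exists_finset_forall_exists_nsmul_le {n m : ℕ} {x : CStarMatrix (Fin n) (Fin n) A}
    {b : CStarMatrix (Fin m) (Fin m) A} (hx : 0 ≤ x) (hb : 0 ≤ b) {p q s : ℕ}
    (h : p • mk x hx + s • unit A ≤ q • mk b hb) {ε : ℝ} (hε : 0 < ε) :
    ∃ (F : Finset A) (η : ℝ), 0 < η ∧ ∀ (C : Type u) [CStarAlgebra C] [PartialOrder C]
      [StarOrderedRing C] (φ : C →⋆ₐ[ℂ] A), Function.Injective φ →
      (∀ a ∈ F, Metric.infDist a (Set.range φ) < η) →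
        ∃ (x' : CStarMatrix (Fin n) (Fin n) C) (b' : CStarMatrix (Fin m) (Fin m) C)
          (hx' : 0 ≤ x') (hb' : 0 ≤ b'), ‖matrixHom (Fin n) φ x' - x‖ < ε ∧
          CuntzSub (matrixHom (Fin m) φ b') b ∧
          p • mk x' hx' + s • unit C ≤ q • mk b' hb' := by
  classical
  have h1 : mk (blockSum (replicate (Fin p) x) (1 : CStarMatrix (Fin s) (Fin s) A))
      (blockSum_nonneg (replicate_nonneg hx) zero_le_one) ≤
      mk (replicate (Fin q) b) (replicate_nonneg hb) := by
    rw [← mk_add_mk (replicate_nonneg hx) (zero_le_one (α := CStarMatrix (Fin s) (Fin s) A)),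
      mk_replicate, mk_replicate, mk_one]
    simpa using h
  rw [mk_le_mk_iff] at h1
  -- The bound ε/2 keeps the cut-down of x close to x; the bound 1/2 keeps the class of the cut-down
  -- unit above that of the unit.
  set ε₁ := min (ε / 2) (1 / 2) with hε₁
  have hε₁0 : 0 < ε₁ := lt_min (half_pos hε) one_half_pos
  have hε₁1 : ε₁ < 1 := (min_le_right _ _).trans_lt one_half_lt_one
  obtain ⟨v, hv⟩ := h1 ε₁ hε₁0
  have hcont : Continuous fun w : CStarMatrix (Fin q × Fin m) (Fin p × Fin n ⊕ Fin s) A ×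
      CStarMatrix (Fin m) (Fin m) A × CStarMatrix (Fin n) (Fin n) A =>
      ‖w.1.conjTranspose * replicate (Fin q) w.2.1 * w.1 -
        blockSum (replicate (Fin p) w.2.2) (1 : CStarMatrix (Fin s) (Fin s) A)‖ := by
    refine ((CStarMatrix.continuous_rect_mul (CStarMatrix.continuous_rect_mul
      (CStarMatrix.continuous_conjTranspose continuous_fst)
      (continuous_replicate.comp (continuous_fst.comp continuous_snd))) continuous_fst).sub
      (continuous_blockSum (continuous_replicate.comp (continuous_snd.comp continuous_snd))
        continuous_const)).norm
  obtain ⟨δ₀, hδ₀, hball⟩ := Metric.eventually_nhds_iff.mp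
    ((hcont.continuousAt (x := (v, b, x))).eventually_lt continuousAt_const hv)
  set δ := min δ₀ (ε / 2) with hδ
  have hδ0 : 0 < δ := lt_min hδ₀ (half_pos hε)
  -- Factors t, k with b = t*t and x = k*k are approximated in place of b and x, so that the lifts
  -- to C are positive.
  obtain ⟨t, ht⟩ := exists_eq_star_mul_self_of_nonneg hb
  obtain ⟨k, hk⟩ := exists_eq_star_mul_self_of_nonneg hx
  have hsq : ∀ {l : ℕ}, Continuous fun y : CStarMatrix (Fin l) (Fin l) A => star y * y :=
    fun {l} => CStarMatrix.continuous_rect_mul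
      (CStarMatrix.continuous_conjTranspose continuous_id) continuous_id
  obtain ⟨δt, hδt, hballt⟩ := Metric.continuousAt_iff.mp (hsq.continuousAt (x := t)) (δ / 2)
    (half_pos hδ0)
  obtain ⟨δk, hδk, hballk⟩ := Metric.continuousAt_iff.mp (hsq.continuousAt (x := k)) δ hδ0
  obtain ⟨F₁, η₁, hη₁, H₁⟩ := exists_finset_forall_exists_norm_map_sub_lt v hδ₀
  obtain ⟨F₂, η₂, hη₂, H₂⟩ := exists_finset_forall_exists_norm_map_sub_lt t hδt
  obtain ⟨F₃, η₃, hη₃, H₃⟩ := exists_finset_forall_exists_norm_map_sub_lt k hδk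
  refine ⟨F₁ ∪ F₂ ∪ F₃, min (min η₁ η₂) η₃, lt_min (lt_min hη₁ hη₂) hη₃, ?_⟩
  intro C _ _ _ φ hφ hF
  obtain ⟨v', hv'⟩ := H₁ C φ fun a ha => (hF a (by simp [ha])).trans_le
    ((min_le_left _ _).trans (min_le_left _ _))
  obtain ⟨t', ht'⟩ := H₂ C φ fun a ha => (hF a (by simp [ha])).trans_le
    ((min_le_left _ _).trans (min_le_right _ _))
  obtain ⟨k', hk'⟩ := H₃ C φ fun a ha => (hF a (by simp [ha])).trans_le (min_le_right _ _)
  set b₀ := star t' * t' with hb₀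
  set x₀ := star k' * k' with hx₀
  have hb₀0 : 0 ≤ b₀ := star_mul_self_nonneg t'
  have hx₀0 : 0 ≤ x₀ := star_mul_self_nonneg k'
  have hφb₀ : ‖matrixHom (Fin m) φ b₀ - b‖ < δ / 2 := by
    rw [hb₀, map_mul, map_star, ht, ← dist_eq_norm]
    exact hballt (by rw [dist_eq_norm]; exact ht')
  have hφx₀ : ‖matrixHom (Fin n) φ x₀ - x‖ < δ := by
    rw [hx₀, map_mul, map_star, hk, ← dist_eq_norm]
    exact hballk (by rw [dist_eq_norm]; exact hk')
  -- Since φ(b₀) is within δ/2 of b, this cut-down gives φ(b') ≾ b exactly, at the cost of another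
  -- δ/2.
  set b' := cutDown b₀ (δ / 2) with hb'
  have hφb' : ‖matrixHom (Fin m) φ b' - b‖ < δ := by
    have h2 := norm_sub_le_norm_sub_add_norm_sub (matrixHom (Fin m) φ b') (matrixHom (Fin m) φ b₀) b
    rw [← map_sub, norm_matrixHom hφ] at h2
    have h3 := norm_cutDown_sub_le hb₀0 (half_pos hδ0).le
    linarith
  refine ⟨cutDown x₀ ε₁, b', cutDown_nonneg _ _, cutDown_nonneg _ _, ?_, ?_, ?_⟩
  · have h2 := norm_sub_le_norm_sub_add_norm_sub (matrixHom (Fin n) φ (cutDown x₀ ε₁))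
      (matrixHom (Fin n) φ x₀) x
    rw [← map_sub, norm_matrixHom hφ] at h2
    have h3 := norm_cutDown_sub_le hx₀0 hε₁0.le
    have h4 : ε₁ ≤ ε / 2 := min_le_left _ _
    have h5 : δ ≤ ε / 2 := min_le_right _ _
    linarith
  · rw [hb', map_cutDown _ (.of_nonneg hb₀0)]
    exact CuntzSub.cutDown_of_norm_sub_le (map_nonneg _ hb₀0) hb hφb₀.le
  · have hD0 : 0 ≤ blockSum (replicate (Fin p) x₀) (1 : CStarMatrix (Fin s) (Fin s) C) :=
      blockSum_nonneg (replicate_nonneg hx₀0) zero_le_one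
    have hnear : ‖v'.conjTranspose * replicate (Fin q) b' * v' -
        blockSum (replicate (Fin p) x₀) (1 : CStarMatrix (Fin s) (Fin s) C)‖ < ε₁ := by
      -- Injective `*`-homomorphisms are isometric, so the estimate in C may be checked in A.
      rw [← norm_matrixHom hφ, map_sub]
      simp only [matrixHom_apply, CStarMatrix.map_rect_mul, CStarMatrix.map_conjTranspose,
        map_blockSum, map_replicate, CStarMatrix.map_one_apply]
      refine @hball (v'.map φ, b'.map φ, x₀.map φ) ?_
      rw [Prod.dist_eq, Prod.dist_eq, max_lt_iff, max_lt_iff, dist_eq_norm, dist_eq_norm,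
        dist_eq_norm]
      exact ⟨hv', hφb'.trans_le (min_le_left _ _), hφx₀.trans_le (min_le_left _ _)⟩
    have h2 := (CuntzSub.cutDown_of_norm_sub_le hD0
      (CStarMatrix.conjTranspose_mul_mul_nonneg (replicate_nonneg (cutDown_nonneg b₀ (δ / 2))) v')
      ((norm_sub_rev _ _).trans_le hnear.le)).trans (CuntzSub.conj v' _)
    rw [cutDown_blockSum (replicate_nonneg hx₀0)
      (zero_le_one (α := CStarMatrix (Fin s) (Fin s) C)), cutDown_replicate hx₀0,
      ← mk_le_mk_iff (blockSum_nonneg (replicate_nonneg (cutDown_nonneg _ _))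
        (cutDown_nonneg _ _)) (replicate_nonneg (cutDown_nonneg _ _)),
      ← mk_add_mk (replicate_nonneg (cutDown_nonneg _ _)) (cutDown_nonneg _ _),
      mk_replicate (cutDown_nonneg _ _), mk_replicate (cutDown_nonneg _ _)] at h2
    refine le_trans (add_le_add le_rfl ?_) h2
    have h3 := mk_one_le_mk_cutDown_one (A := C) (ι := Fin s) hε₁1
    rwa [mk_one, Fintype.card_fin] at h3

end Transfer

/-! ### From dimension functions to comparison. -/

section Comparison

variable {A : Type u} [CStarAlgebra A] [PartialOrder A] [StarOrderedRing A]

open CuntzSemigroup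

/-- The algebraic consequence of strict inequalities between dimension functions. -/
lemma exists_nsmul_add_nsmul_unit_le (hA : AllQuotientsStablyFinite A) {r : ℝ} (hr : 0 ≤ r)
    {n m : ℕ} {a : CStarMatrix (Fin n) (Fin n) A} {b : CStarMatrix (Fin m) (Fin m) A}
    (ha : 0 ≤ a) (hb : 0 ≤ b)
    (h : ∀ d : LowerSemicontinuousDimensionFunction A, d.toFun n a + r < d.toFun m b)
    {ε : ℝ} (hε : 0 < ε) :
    ∃ (p q s : ℕ) (r' : ℝ), r < r' ∧ p ≤ q ∧ 0 < q ∧ r' * q + ((q : ℝ) - p) * n < s ∧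
      p • mk (cutDown a ε) (cutDown_nonneg a ε) + s • unit A ≤ q • mk b hb := by
  obtain ⟨N', hN'⟩ := exists_unit_le_nsmul hA hb fun d =>
    lt_of_le_of_lt (add_nonneg (d.nonneg a ha) hr) (h d)
  set x := mk (cutDown a ε) (cutDown_nonneg a ε) with hx
  rcases exists_state_or (unit A) CuntzSemigroup.zero_le exists_le_nsmul_unit x (mk b hb) r hr with
    ⟨f, hf, hu, hfb⟩ | ⟨n₀, s₀, hn₀, hs₀, z, hz⟩
  · have h1 := h (dimensionFunctionOfState f hf hu)
    have h2 : (dimensionFunctionOfState f hf hu).toFun m b ≤ f (mk b hb) :=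
      lscRegularization_le hf hb
    have h3 : f x ≤ (dimensionFunctionOfState f hf hu).toFun n a :=
      apply_mk_cutDown_le_lscRegularization hf ha hε
    linarith
  obtain ⟨N, hN⟩ := exists_le_nsmul_unit z
  have hn₀' : (0 : ℝ) < n₀ := by exact_mod_cast hn₀
  obtain ⟨r', hrr', hr's⟩ := exists_between ((lt_div_iff₀ hn₀').mpr hs₀)
  rw [lt_div_iff₀ hn₀'] at hr's
  -- Fullness of b absorbs z: z ≤ N[1] ≤ NN'[b].
  set M := N * N' with hM
  have hzM : z ≤ M • mk b hb := by
    rw [hM, mul_smul]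
    exact hN.trans (nsmul_le_nsmul_right hN' N)
  -- With q - p = M, the required bound becomes M(n + r') < (k + 1)(s₀ - r'n₀).
  obtain ⟨k, hk⟩ := exists_nat_gt ((M * (n + r') : ℝ) / (s₀ - r' * n₀))
  rw [div_lt_iff₀ (by linarith)] at hk
  refine ⟨(k + 1) * n₀, (k + 1) * n₀ + M, (k + 1) * s₀, r', hrr', Nat.le_add_right _ _,
    by positivity, ?_, ?_⟩
  · push_cast
    nlinarith
  · have h1 := exists_nsmul_le_of_add_le_add CuntzSemigroup.zero_le hz (k + 1)
    rw [smul_add, ← mul_smul, ← mul_smul, ← mul_smul] at h1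
    rw [add_smul]
    exact h1.trans (add_le_add le_rfl hzM)

end Comparison

theorem mainTheorem6 (A : Type u) [CStarAlgebra A] [PartialOrder A] [StarOrderedRing A]
    (hA : AllQuotientsStablyFinite A) (r : ℝ) (hr : 0 ≤ r)
    (happrox : ∀ (F : Finset A) (ε : ℝ), 0 < ε →
      ∃ (C : Type u) (_ : CStarAlgebra C) (_ : PartialOrder C) (_ : StarOrderedRing C),
        AllQuotientsStablyFinite C ∧
        radiusOfComparison C < ENNReal.ofReal (r + ε) ∧
        ∃ φ : C →⋆ₐ[ℂ] A, Function.Injective φ ∧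
          ∀ a ∈ F, Metric.infDist a (Set.range φ) < ε) :
    radiusOfComparison A ≤ ENNReal.ofReal r := by
  suffices hcomp : HasComparison A ⟨r, hr⟩ by
    rw [ENNReal.ofReal_eq_coe_nnreal hr]
    exact iInf₂_le _ hcomp
  intro n m a b ha hb h
  rw [cuntzLE_iff_cuntzSub]
  refine CuntzSub.of_forall_near fun ε hε => ?_
  obtain ⟨p, q, s, r', hrr', hpq, hq, hs, hle⟩ :=
    exists_nsmul_add_nsmul_unit_le hA hr ha hb h (half_pos hε)
  obtain ⟨F, η, hη, H⟩ := exists_finset_forall_exists_nsmul_le (cutDown_nonneg a (ε / 2)) hb hle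
    (half_pos hε)
  -- The tolerance r' - r ensures rc(C) < r'.
  obtain ⟨C, _, _, _, -, hrc, φ, hφ, hF⟩ := happrox F (min η (r' - r))
    (lt_min hη (sub_pos.mpr hrr'))
  obtain ⟨x, y, hx, hy, hxa, hyb, hxy⟩ := H C φ hφ fun c hc => (hF c hc).trans_le (min_le_left _ _)
  obtain ⟨r₀, hr₀, hlt⟩ : ∃ r₀ : NNReal, HasComparison C r₀ ∧ (r₀ : ℝ) < r' := by
    simp only [radiusOfComparison, iInf_lt_iff] at hrc
    obtain ⟨r₀, hr₀, hlt⟩ := hrc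
    refine ⟨r₀, hr₀, ?_⟩
    have h1 : (r₀ : ENNReal) < ENNReal.ofReal r' :=
      hlt.trans_le (ENNReal.ofReal_le_ofReal (by linarith [min_le_right η (r' - r)]))
    rw [← ENNReal.ofReal_coe_nnreal] at h1
    exact (ENNReal.ofReal_lt_ofReal_iff_of_nonneg r₀.2).mp h1
  have hcuntz : CuntzSub x y := by
    -- Using d(x) ≤ n, q d(x) + q r₀ < p d(x) + (q - p)n + q r' < p d(x) + s ≤ q d(y).
    refine hr₀ n m x y hx hy fun d => ?_
    have h1 := d.toAddMonoidHom_mono hxy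
    have h2 := d.toAddMonoidHom_mono (CuntzSemigroup.mk_le_card_nsmul_unit hx)
    simp only [map_add, map_nsmul, d.toAddMonoidHom_unit, d.toAddMonoidHom_mk, nsmul_eq_mul,
      mul_one, Fintype.card_fin] at h1 h2
    have hq' : (0 : ℝ) < q := by exact_mod_cast hq
    have hpq' : (p : ℝ) ≤ q := by exact_mod_cast hpq
    have h3 := mul_le_mul_of_nonneg_left h2 (sub_nonneg.mpr hpq')
    have h4 := mul_lt_mul_of_pos_right hlt hq'
    refine lt_of_mul_lt_mul_left ?_ hq'.le
    linarith
  refine ⟨matrixHom (Fin n) φ x, ?_, (hcuntz.map hφ).trans hyb⟩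
  have h1 := norm_cutDown_sub_le ha (half_pos hε).le
  have h2 := norm_sub_le_norm_sub_add_norm_sub (matrixHom (Fin n) φ x) (cutDown a (ε / 2)) a
  linarith
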